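/- **Setting.** A video has chunks $i=1,\dots,C$ of $L\ge 1$ seconds and layers $n=0,\dots,N$ (layer $0$ is the base layer). Layer $n$ of a chunk has size $Y_n=L\,r_n>0$. With startup delay $s\in\mathbb N$, chunk $i$ has the deadline $d_i=(i-1)L+s$. Link $k\in\{1,2\}$ has bandwidth $B^{(k)}(j)\ge 0$ in time slot $j=1,2,\dots$ **Problem.** The variables are the amounts $z_n^{(k)}(i,j)\ge 0$ of layer $n$ of chunk $i$ fetched over link $k$ in slot $j$, the totals $Z_{n,i}^{(k)}=\sum_{j=1}^{d_i}z_n^{(k)}(i,j)$, the sizes $Z_{n,i}$, and the decisions $I_{n,i}^{(k)}\in\{0,1\}$, where $I_{n,i}^{(k)}=1$ if and only if link $k$ fetches layer $n$ of chunk $i$, i.e. $Z^{(k)}_{n,i}=Y_n$. Maximize $$\sum_{i=1}^C\sum_{n=0}^N\big(\lambda_n^{(1)}I_{n,i}^{(1)}+\lambda_n^{(2)}I_{n,i}^{(2)}\big)$$ subject to $I_{n,i}^{(1)}Z_{n,i}^{(1)}+I_{n,i}^{(2)}Z_{n,i}^{(2)}=Z_{n,i}\in\{0,Y_n\}$; $Z_{n,i}\le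 \frac{Y_n}{Y_{n-1}}Z_{n-1,i}$ for $n\ge1$; $\sum_{n,i}z_n^{(k)}(i,j)\le B^{(k)}(j)$; $Z_{n,i}^{(1)}Z_{n,i}^{(2)}=0$; $z_n^{(k)}(i,j)=0$ for $j>d_i$; and $z_n^{(2)}(i,j)=0$ for $n\ge 1$ (link 2 may fetch base layers only). **Weights.** For all $0\le a\le N$, $$\lambda_a^{(1)}>C\Big(\sum_{n=a}^N\lambda_n^{(2)}+\sum_{n=a+1}^N\lambda_n^{(1)}\Big),\qquad \lambda_a^{(2)}>C\sum_{n=a+1}^N\lambda_n^{(2)}Y_n,$$ and all enhancement layers together have less utility than one base layer: $\lambda_0^{(2)}>C\sum_{n=1}^N\lambda_n^{(1)}$. **Algorithm (Avoid-Skips MP-SVC).** Process the layers $n=0,\dots,N$ in order, with the residual bandwidths left by the earlier layers; for $n\ge1$ the bandwidth of link 2 is taken to be $0$. Let $V^{(k)}_{n,i}$ be $1/Y_n$ times the residual bandwidth of link $k$ up to slot $d_i$, rounded down. The candidates are all chunks if $n=0$, and the chunks whose layer $n-1$ is fetched if $n\ge1$. 1. *Forward scan.* $\mathrm{skip}(0)=0$;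 for $i=1,\dots,C$, $\mathrm{skip}(i)=\mathrm{skip}(i-1)+1$ if $V^{(1)}_{n,i}+V^{(2)}_{n,i}<i-\mathrm{skip}(i-1)$ or $i$ is not a candidate, and $\mathrm{skip}(i)=\mathrm{skip}(i-1)$ otherwise. The first $A=\mathrm{skip}(C)$ chunks are skipped. 2. *Moves (only for $n=0$).* Start with $M_1=\{A+1,\dots,C\}$, $M_2=\emptyset$. For $i=1,\dots,C$: as long as $M_1$ has more than $V_{0,i}^{(1)}$ elements $\le i$, move from $M_1$ to $M_2$ the earliest chunk of $M_1$ that link 2 can fetch, i.e. the least $m\in M_1$ such that $M_2\cup\{m\}$ has at most $V^{(2)}_{0,i'}$ elements $\le i'$ for all $i'$ (stop if there is none). 3. *Backward scan.* For each candidate $i=A+1,\dots,C$ in order: for each link, simulate fetching layer $n$ of chunk $i$ from slot $d_i$ backwards in time, using in each slot as much residual bandwidth as possible; here link 2 counts as having bandwidth $0$ if $n\ge1$ or $i\in M_1$, and link 1 if $n=0$ and $i\in M_2$. The cost of a link is the amount fetched in slots $\le d_{i-1}=(i-2)L+s$, or $\infty$ if the layer cannot be fetched. The layer is assigned to the link of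 least cost, whose residual bandwidth is updated. Let $I^*$ be the resulting decisions. **Theorem.** $I^*$ is the decision part of a feasible point of the problem, and it is optimal: no feasible point has a larger objective. More generally, for every $0\le M\le N$ and every feasible point with decisions $I'$, $$\sum_{i=1}^C\sum_{n=0}^M\big(\lambda_n^{(1)}I_{n,i}^{\prime(1)}+\lambda_n^{(2)}I_{n,i}^{\prime(2)}\big)\le\sum_{i=1}^C\sum_{n=0}^M\big(\lambda_n^{(1)}I_{n,i}^{*(1)}+\lambda_n^{(2)}I_{n,i}^{*(2)}\big).$$ -/

import Mathlib

open Finset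
open scoped BigOperators

noncomputable section

namespace SVCStream

/-- The two links; `one` is the preferred link. -/
inductive Link
  | one
  | two
  deriving DecidableEq

/-- Data of the offline problem: `C` chunks `1, …, C` of length `L` seconds, layers `0, …, N`
(`0` is the base layer) with rates `r n`, startup delay `s`, and bandwidth `B k j` of link `k` in
the time slot `j = 1, 2, …` -/
structure Instance where
  C : ℕ
  N : ℕ
  L : ℕ
  s : ℕ
  r : ℕ → ℝ
  B : Link → ℕ → ℝ
  L_pos : 0 < L
  r_pos : ∀ n ≤ N, 0 < r n
  B_nonneg : ∀ k j, 0 ≤ B k j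

namespace Instance

variable (P : Instance)

/-- Size of layer `n` of a chunk. -/
def Y (n : ℕ) : ℝ := P.L * P.r n

/-- Deadline of chunk `i` (used for `i ≥ 1`). -/
def deadline (i : ℕ) : ℕ := (i - 1) * P.L + P.s

end Instance

/-! ### The optimization problem -/

/-- Values of all variables. `z k n i j` is the amount of layer `n` of chunk `i` fetched over link
`k` in slot `j`; `Zl k n i` is the total over the slots; `Z n i` is the fetched size of the layer;
`I k n i` is the decision variable. -/
structure Policy where
  z : Link → ℕ → ℕ → ℕ → ℝ
  Zl : Link → ℕ → ℕ → ℝ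
  Z : ℕ → ℕ → ℝ
  I : Link → ℕ → ℕ → ℝ

/-- The constraints, with link 2 restricted to the layers `0, …, n₂`. -/
structure Feasible (P : Instance) (n₂ : ℕ) (x : Policy) : Prop where
  /-- total amount fetched over a link -/
  total : ∀ k, ∀ n ≤ P.N, ∀ i ∈ Icc 1 P.C,
    ∑ j ∈ Icc 1 (P.deadline i), x.z k n i j = x.Zl k n i
  /-- the fetched size in terms of the decisions -/
  size : ∀ n ≤ P.N, ∀ i ∈ Icc 1 P.C,
    x.I .one n i * x.Zl .one n i + x.I .two n i * x.Zl .two n i = x.Z n i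
  /-- a layer is useless without the layer below it -/
  nested : ∀ n ∈ Icc 1 P.N, ∀ i ∈ Icc 1 P.C,
    x.Z n i ≤ P.Y n / P.Y (n - 1) * x.Z (n - 1) i
  /-- bandwidth of each link in each slot -/
  bandwidth : ∀ k, ∀ j ∈ Icc 1 (P.deadline P.C),
    ∑ n ∈ range (P.N + 1), ∑ i ∈ Icc 1 P.C, x.z k n i j ≤ P.B k j
  /-- a layer of a chunk is not split over the links -/
  unsplit : ∀ n ≤ P.N, ∀ i ∈ Icc 1 P.C, x.Zl .one n i * x.Zl .two n i = 0
  nonneg : ∀ k, ∀ n ≤ P.N, ∀ i ∈ Icc 1 P.C, ∀ j ∈ Icc 1 (P.deadline P.C), 0 ≤ x.z k n i j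
  /-- link 2 fetches no layer above `n₂` -/
  preference : ∀ n ≤ P.N, n₂ < n → ∀ i ∈ Icc 1 P.C, ∀ j ∈ Icc 1 (P.deadline P.C),
    x.z .two n i j = 0
  /-- nothing is fetched after the deadline -/
  inTime : ∀ k, ∀ n ≤ P.N, ∀ i ∈ Icc 1 P.C, ∀ j ∈ Icc 1 (P.deadline P.C),
    P.deadline i < j → x.z k n i j = 0
  /-- no partial layers -/
  whole : ∀ n ≤ P.N, ∀ i ∈ Icc 1 P.C, x.Z n i = 0 ∨ x.Z n i = P.Y n
  binary : ∀ k, ∀ n ≤ P.N, ∀ i ∈ Icc 1 P.C, x.I k n i = 0 ∨ x.I k n i = 1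
  /-- meaning of the decision variable: it is `1` exactly if link `k` fetches the layer -/
  decision : ∀ k, ∀ n ≤ P.N, ∀ i ∈ Icc 1 P.C, (x.I k n i = 1 ↔ x.Zl k n i = P.Y n)

/-- The weighted objective, counting the layers `0, …, M` only. For `M = N` it is the objective
of the problem. -/
def objective (P : Instance) (lam : Link → ℕ → ℝ) (M : ℕ) (I : Link → ℕ → ℕ → ℝ) : ℝ :=
  ∑ i ∈ Icc 1 P.C, ∑ n ∈ range (M + 1), (lam .one n * I .one n i + lam .two n * I .two n i)

/-! ### The Avoid-Skips MP-SVC algorithm -/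

/-- Backward scan: fetch the amount `y` from the bandwidth profile `b` of one link, starting in
slot `j` and going back in time. Returns the residual profile and the cost, i.e. the amount that
is fetched in slots `≤ t`, or `⊤` if slot `1` is passed before everything is fetched. -/
def backward (t : ℤ) : ℕ → ℝ → (ℕ → ℝ) → (ℕ → ℝ) × WithTop ℝ
  | 0, y, b => (b, if 0 < y then ⊤ else 0)
  | j + 1, y, b =>
    if 0 < y then
      let fetched := min (b (j + 1)) y
      let rest := backward t j (y - fetched) (Function.update b (j + 1) (b (j + 1) - fetched))
      (rest.1, (if ((j + 1 : ℕ) : ℤ) ≤ t then (fetched : WithTop ℝ) else 0) + rest.2)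
    else (b, 0)

/-- Residual bandwidth of the links and the sets of chunks whose layer (the one being processed)
is fetched over each link. -/
structure State where
  B : Link → ℕ → ℝ
  I : Link → Finset ℕ

namespace Instance

variable (P : Instance)

/-- Number of copies of layer `n` that the profile `b` can carry up to the deadline of chunk `i`. -/
def V (n : ℕ) (b : ℕ → ℝ) (i : ℕ) : ℕ := ⌊(∑ j ∈ Icc 1 (P.deadline i), b j) / P.Y n⌋₊

/-- Forward scan for layer `n`: the number of skips up to chunk `i`, where `cand` is the set of
chunks that may receive layer `n`. -/
def skip (n : ℕ) (B : Link → ℕ → ℝ) (cand : Finset ℕ) : ℕ → ℕ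
  | 0 => 0
  | i + 1 =>
    if P.V n (B .one) (i + 1) + P.V n (B .two) (i + 1) + skip n B cand i < i + 1 ∨ i + 1 ∉ cand
    then skip n B cand i + 1
    else skip n B cand i

/-- Link 2 can fetch the base layers of all chunks in `S` before their deadlines. -/
def Fits (B : Link → ℕ → ℝ) (S : Finset ℕ) : Prop :=
  ∀ i ∈ Icc 1 P.C, #{m ∈ S | m ≤ i} ≤ P.V 0 (B .two) i

open Classical in
/-- One pass through the body of the while loop at chunk `i`. The pair `M` holds the chunks whose
base layer is assigned to link 1 and to link 2. If link 1 cannot fetch in time all of its chunks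
up to `i`, the earliest of its chunks that link 2 can fetch (together with those assigned to link 2
already) is moved to link 2; otherwise nothing changes. -/
def moveStep (B : Link → ℕ → ℝ) (i : ℕ) (M : Finset ℕ × Finset ℕ) : Finset ℕ × Finset ℕ :=
  if h : P.V 0 (B .one) i < #{m ∈ M.1 | m ≤ i} ∧ {m ∈ M.1 | P.Fits B (insert m M.2)}.Nonempty then
    let move := {m ∈ M.1 | P.Fits B (insert m M.2)}.min' h.2
    (M.1.erase move, insert move M.2)
  else M

/-- Base layer assignment `(M₁, M₂)` when the first `A` chunks are skipped. At each chunk `i`, in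
order, the while loop runs until nothing changes (at most `C` chunks can be moved). -/
def moves (B : Link → ℕ → ℝ) (A : ℕ) : Finset ℕ × Finset ℕ :=
  (List.range' 1 P.C).foldl (fun M i => (P.moveStep B i)^[P.C] M) (Icc (A + 1) P.C, ∅)

/-- Processing of chunk `i` for layer `n`. The link `allowed` is scanned with its residual
bandwidth, the other one with bandwidth zero, and the layer goes to the link of least cost. The cost
threshold is the deadline of chunk `i - 1`. -/
def fetchStep (n : ℕ) (allowed : Link) (i : ℕ) (σ : State) : State :=
  let b : Link → ℕ → ℝ := fun k => if k = allowed then σ.B k else 0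
  let res := fun k => backward (((i : ℤ) - 2) * P.L + P.s) (P.deadline i) (P.Y n) (b k)
  let k₁ : Link := if (res .one).2 ≤ (res .two).2 then .one else .two
  { B := Function.update σ.B k₁ (res k₁).1
    I := Function.update σ.I k₁ (insert i (σ.I k₁)) }

/-- Backward pass for layer `n` over the chunks `A + 1, …, C`, skipping those outside `cand`. -/
def fetchAll (n A : ℕ) (cand : Finset ℕ) (allowed : ℕ → Link) (B : Link → ℕ → ℝ) : State :=
  (List.range' (A + 1) (P.C - A)).foldl
    (fun σ i => if i ∈ cand then P.fetchStep n (allowed i) i σ else σ) ⟨B, fun _ => ∅⟩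

/-- The base layer. -/
def baseRun : State :=
  let cand := Icc 1 P.C
  let A := P.skip 0 P.B cand P.C
  let M := P.moves P.B A
  P.fetchAll 0 A cand (fun i => if i ∈ M.1 then .one else .two) P.B

/-- An enhancement layer `n`, after the state `σ` of layer `n - 1`; link 2 has bandwidth zero. -/
def enhRun (n : ℕ) (σ : State) : State :=
  let cand := σ.I .one ∪ σ.I .two
  let A := P.skip n (Function.update σ.B .two 0) cand P.C
  P.fetchAll n A cand (fun _ => .one) σ.B

/-- State after layer `n`. -/
def run : ℕ → State
  | 0 => P.baseRun
  | n + 1 => P.enhRun (n + 1) (run n)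

/-- Decision variables that the algorithm outputs. -/
def avoidSkips (k : Link) (n i : ℕ) : ℝ := if i ∈ (P.run n).I k then 1 else 0

end Instance

end SVCStream

end

namespace SVCStream

/-! ### Counting functions of sets of chunks -/

/-! The objective depends only on how many chunks each link fetches per layer. The weights rank
these numbers: base layers on link 1, base layers on link 2, then enhancement layers 1, 2, … on link
1. Each weight is at least `C` times the sum of the later ones, so (`sum_le_sum_of_lex`) it suffices
to show: if a feasible point agrees with the algorithm in all earlier numbers, its next number is no
larger.

By `FitsIn`, whether a link can carry a set of base layers depends only on the set's counting
function. Sets that fit have the matroid exchange property (`FitsIn.augment`). So the greedy moves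
keep the invariant `MoveInv`: link 2 holds the earliest chunks possible for its load, and its load
is never more than necessary. Hence link 1 carries the largest possible number of base layers
(`MoveInv.card_fst_max`), placed as late as possible (`MoveInv.cnt_fst_le`). The total number of
base layers is maximal because a skip is witnessed by a deadline with too little bandwidth
(`skip_tight`).

For an enhancement layer, equal earlier numbers mean that the algorithm's sets on link 1 have
pointwise the smallest counting functions, since enhancement layers occupy suffixes. Fetching
backwards touches early slots only when the later ones up to the deadline are exhausted, so the
residual bandwidth up to a deadline is bounded below by total bandwidth minus demand at some later
deadline (`run_lower`). The competitor's next layer therefore fits into the algorithm's residual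
bandwidth, and the forward scan bounds its size (`Choice.enh_le`). -/

/-- Number of elements of `S` that are at most `i`. -/
def cnt (S : Finset ℕ) (i : ℕ) : ℕ := #{m ∈ S | m ≤ i}

theorem cnt_mono_set {S T : Finset ℕ} (h : S ⊆ T) (i : ℕ) : cnt S i ≤ cnt T i :=
  card_le_card (filter_subset_filter _ h)

theorem cnt_mono (S : Finset ℕ) {i j : ℕ} (h : i ≤ j) : cnt S i ≤ cnt S j := by
  apply card_le_card
  intro m hm
  simp only [mem_filter] at hm ⊢
  exact ⟨hm.1, hm.2.trans h⟩

theorem cnt_le_card (S : Finset ℕ) (i : ℕ) : cnt S i ≤ #S := card_le_card (filter_subset _ _)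

theorem cnt_insert {S : Finset ℕ} {e : ℕ} (he : e ∉ S) (i : ℕ) :
    cnt (insert e S) i = cnt S i + if e ≤ i then 1 else 0 := by
  unfold cnt
  rw [filter_insert]
  split_ifs with h
  · rw [card_insert_of_notMem (by simp [he])]
  · simp

theorem cnt_union {S T : Finset ℕ} (h : Disjoint S T) (i : ℕ) :
    cnt (S ∪ T) i = cnt S i + cnt T i := by
  unfold cnt
  rw [filter_union, card_union_of_disjoint (disjoint_filter_filter h)]

theorem cnt_Icc (a c i : ℕ) : cnt (Icc a c) i = min i c + 1 - a := by
  unfold cnt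
  rw [show {m ∈ Icc a c | m ≤ i} = Icc a (min i c) by ext m; simp; tauto, Nat.card_Icc]

/-- At most `C - i` chunks come after `i`. This is the source of all bounds by skips and suffixes.
-/
theorem card_le_cnt_add {S : Finset ℕ} {C : ℕ} (h : S ⊆ Icc 1 C) {i : ℕ} (hi : i ≤ C) :
    #S ≤ cnt S i + (C - i) := by
  have h1 : S ⊆ {m ∈ S | m ≤ i} ∪ Icc (i + 1) C := by
    intro m hm
    have := h hm
    simp only [mem_Icc, mem_union, mem_filter] at this ⊢
    by_cases hmi : m ≤ i
    · exact Or.inl ⟨hm, hmi⟩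
    · right; omega
  have h2 := (card_le_card h1).trans (card_union_le _ _)
  rw [Nat.card_Icc] at h2
  unfold cnt
  omega

/-- Among sets of a given size, the suffix is the latest and so the easiest to carry. -/
theorem cnt_suffix_le {S : Finset ℕ} {C k : ℕ} (h : S ⊆ Icc 1 C) (hk : k ≤ #S) {i : ℕ}
    (hi : i ≤ C) : cnt (Icc (C - k + 1) C) i ≤ cnt S i := by
  have := card_le_cnt_add h hi
  rw [cnt_Icc]
  omega

/-! ### Sets of chunks that one link can carry -/

/-- The sets `S` of chunks in which the chunks up to `i` number at most `v i`. -/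
def FitsIn (C : ℕ) (v : ℕ → ℕ) (S : Finset ℕ) : Prop := ∀ i ∈ Icc 1 C, cnt S i ≤ v i

theorem FitsIn.mono {C : ℕ} {v : ℕ → ℕ} {S T : Finset ℕ} (h : FitsIn C v T) (hST : S ⊆ T) :
    FitsIn C v S := fun i hi => (cnt_mono_set hST i).trans (h i hi)

/-- Exchange property of the sets that fit. -/
theorem FitsIn.augment {C : ℕ} {v : ℕ → ℕ} {S T : Finset ℕ} (hS : FitsIn C v S)
    (hT : FitsIn C v T) (hcard : #S < #T) :
    ∃ e ∈ T, e ∉ S ∧ FitsIn C v (insert e S) := by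
  have hne : (T \ S).Nonempty := by
    rw [sdiff_nonempty]
    intro h
    exact absurd (card_le_card h) (by omega)
  -- With the largest choice of `e`, every element of `T` beyond some `i ≥ e` lies in `S`. Since `#S
  -- < #T`, this forces `cnt S i < cnt T i ≤ v i`, which leaves room for `e`.
  set e := (T \ S).max' hne with he
  have hemem : e ∈ T \ S := max'_mem _ _
  rw [mem_sdiff] at hemem
  refine ⟨e, hemem.1, hemem.2, fun i hi => ?_⟩
  rw [cnt_insert hemem.2]
  split_ifs with hei
  · have h1 : {m ∈ T | ¬ m ≤ i} ⊆ {m ∈ S | ¬ m ≤ i} := by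
      intro m hm
      simp only [mem_filter] at hm ⊢
      refine ⟨?_, hm.2⟩
      by_contra hmS
      have := le_max' (T \ S) m (mem_sdiff.2 ⟨hm.1, hmS⟩)
      rw [← he] at this
      omega
    have h2 := card_le_card h1
    have h3 := card_filter_add_card_filter_not (s := T) (fun m => m ≤ i)
    have h4 := card_filter_add_card_filter_not (s := S) (fun m => m ≤ i)
    have h5 := hT i hi
    unfold cnt at *
    omega
  · exact hS i hi

/-- Splitting a suffix of the chunks over two links. -/
theorem exists_split {C A : ℕ} {v₁ v₂ : ℕ → ℕ} (hv₁ : Monotone v₁) (hv₂ : Monotone v₂)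
    (h : ∀ i ∈ Icc 1 C, i ≤ v₁ i + v₂ i + A) :
    ∃ T₁ T₂, Disjoint T₁ T₂ ∧ T₁ ∪ T₂ = Icc (A + 1) C ∧ FitsIn C v₁ T₁ ∧ FitsIn C v₂ T₂ := by
  induction C with
  | zero => exact ⟨∅, ∅, by simp, by simp, by intro i hi; simp at hi, by intro i hi; simp at hi⟩
  | succ c ih =>
    obtain ⟨T₁, T₂, hd, hu, h₁, h₂⟩ := ih fun i hi => h i (by simp at hi ⊢; omega)
    have hlast := h (c + 1) (by simp)
    have hsub : ∀ m, m ∈ T₁ ∪ T₂ → m ≤ c := by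
      intro m hm; rw [hu] at hm; simp at hm; omega
    have hcard : #T₁ + #T₂ = c - A := by
      rw [← card_union_of_disjoint hd, hu, Nat.card_Icc]; omega
    have hn₁ : c + 1 ∉ T₁ := fun hm => by have := hsub _ (mem_union_left _ hm); omega
    have hn₂ : c + 1 ∉ T₂ := fun hm => by have := hsub _ (mem_union_right _ hm); omega
    have ext : ∀ {v : ℕ → ℕ} {T : Finset ℕ}, FitsIn c v T → #T ≤ v (c + 1) →
        FitsIn (c + 1) v T := by
      intro v T hT hc i hi
      rcases Nat.lt_or_ge c i with hci | hci
      · have : i = c + 1 := by simp at hi; omega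
        subst this
        exact (cnt_le_card _ _).trans hc
      · exact hT i (by simp at hi ⊢; omega)
    have ext' : ∀ {v : ℕ → ℕ} {T : Finset ℕ}, FitsIn c v T → c + 1 ∉ T → #T + 1 ≤ v (c + 1) →
        FitsIn (c + 1) v (insert (c + 1) T) := by
      intro v T hT hn hc
      refine ext (fun i hi => ?_) (by rwa [card_insert_of_notMem hn])
      rw [cnt_insert hn, if_neg (by simp at hi; omega)]
      exact hT i hi
    have hle : ∀ {v : ℕ → ℕ} {T : Finset ℕ}, Monotone v → FitsIn c v T → T ⊆ T₁ ∪ T₂ →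
        #T ≤ v (c + 1) := by
      intro v T hv hT hTs
      have hc' : cnt T c = #T := by
        unfold cnt
        rw [filter_true_of_mem fun m hm => hsub m (hTs hm)]
      rcases Nat.eq_zero_or_pos c with rfl | hc
      · have : #T ≤ #(T₁ ∪ T₂) := card_le_card hTs
        rw [hu, Nat.card_Icc] at this
        omega
      · exact (hc' ▸ hT c (by simp; omega)).trans (hv (Nat.le_succ c))
    have hle₁ := hle hv₁ h₁ subset_union_left
    have hle₂ := hle hv₂ h₂ subset_union_right
    rcases Nat.lt_or_ge c A with hcA | hcA
    · exact ⟨T₁, T₂, hd, by rw [hu, Icc_eq_empty (by omega), Icc_eq_empty (by omega)],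
        ext h₁ hle₁, ext h₂ hle₂⟩
    have hI : insert (c + 1) (Icc (A + 1) c) = Icc (A + 1) (c + 1) := by
      ext m; simp only [mem_insert, mem_Icc]; omega
    -- If link 1 is full, then `#T₁ = v₁ (c + 1)`, and the joint bound `hlast` leaves a place on
    -- link 2.
    by_cases h1 : #T₁ + 1 ≤ v₁ (c + 1)
    · exact ⟨insert (c + 1) T₁, T₂, disjoint_insert_left.2 ⟨hn₂, hd⟩,
        by rw [insert_union, hu, hI], ext' h₁ hn₁ h1, ext h₂ hle₂⟩
    · exact ⟨T₁, insert (c + 1) T₂, disjoint_insert_right.2 ⟨hn₁, hd⟩,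
        by rw [union_insert, hu, hI], ext h₁ hle₁, ext' h₂ hn₂ (by omega)⟩

/-- Shifting disjoint sets of chunks to the end, so that they fill a suffix. -/
theorem exists_shift {C A : ℕ} {T₁ T₂ : Finset ℕ} (hd : Disjoint T₁ T₂)
    (hC : T₁ ∪ T₂ ⊆ Icc 1 C) (hcard : #T₁ + #T₂ = C - A) :
    ∃ U₁ U₂, Disjoint U₁ U₂ ∧ U₁ ∪ U₂ = Icc (A + 1) C ∧ #U₁ = #T₁ ∧ #U₂ = #T₂ ∧
      (∀ i, cnt U₁ i ≤ cnt T₁ i) ∧ ∀ i, cnt U₂ i ≤ cnt T₂ i := by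
  rcases Nat.lt_or_ge C A with hCA | hCA
  · have h₁ : T₁ = ∅ := card_eq_zero.1 (by omega)
    have h₂ : T₂ = ∅ := card_eq_zero.1 (by omega)
    subst h₁ h₂
    exact ⟨∅, ∅, by simp, by rw [Icc_eq_empty (by omega)]; rfl, rfl, rfl, by simp, by simp⟩
  set T := T₁ ∪ T₂ with hT
  have hTc : #T = C - A := by rw [hT, card_union_of_disjoint hd, hcard]
  -- The element of rank `q` in `T` goes to `A + q`. This never moves it earlier, because at most `C
  -- - m` elements of `T` exceed `m`.
  let f : ℕ → ℕ := fun m => A + cnt T m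
  have hle : ∀ m ∈ T, m ≤ f m := by
    intro m hm
    have h1 := mem_Icc.1 (hC hm)
    have := card_le_cnt_add hC h1.2
    simp only [f]
    omega
  have hlt : ∀ m ∈ T, ∀ m' ∈ T, m < m' → f m < f m' := by
    intro m _ m' hm' hlt
    simp only [f]
    apply Nat.add_lt_add_left
    apply card_lt_card
    rw [ssubset_iff_of_subset (fun x hx => mem_filter.2
      ⟨(mem_filter.1 hx).1, (mem_filter.1 hx).2.trans hlt.le⟩)]
    exact ⟨m', by simp [hm'], by simp; omega⟩
  have hinj : Set.InjOn f T := by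
    intro m hm m' hm' he
    rcases lt_trichotomy m m' with h | h | h
    · exact absurd he (hlt m hm m' hm' h).ne
    · exact h
    · exact absurd he (hlt m' hm' m hm h).ne'
  have hs₁ : T₁ ⊆ T := subset_union_left
  have hs₂ : T₂ ⊆ T := subset_union_right
  have hcnt : ∀ S ⊆ T, ∀ i, cnt (S.image f) i ≤ cnt S i := by
    intro S hS i
    unfold cnt
    rw [filter_image]
    refine card_image_le.trans (card_le_card fun m hm => ?_)
    simp only [mem_filter] at hm ⊢
    exact ⟨hm.1, (hle m (hS hm.1)).trans hm.2⟩
  refine ⟨T₁.image f, T₂.image f, ?_, ?_, ?_, ?_, hcnt _ hs₁, hcnt _ hs₂⟩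
  · rw [disjoint_left]
    intro x h1 h2
    obtain ⟨a, ha, rfl⟩ := mem_image.1 h1
    obtain ⟨b, hb, hab⟩ := mem_image.1 h2
    have := hinj (hs₂ hb) (hs₁ ha) hab
    subst this
    exact disjoint_left.1 hd ha hb
  · rw [← image_union, ← hT]
    apply eq_of_subset_of_card_le
    · intro x hx
      obtain ⟨m, hm, rfl⟩ := mem_image.1 hx
      have h1 : cnt T m ≤ #T := cnt_le_card _ _
      have h2 : 0 < cnt T m := card_pos.2 ⟨m, by simp [hm]⟩
      simp only [f, mem_Icc]
      omega
    · rw [card_image_of_injOn hinj, hTc, Nat.card_Icc]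
      omega
  · exact card_image_of_injOn (hinj.mono hs₁)
  · exact card_image_of_injOn (hinj.mono hs₂)

/-! ### The assignment of the base layers to the links -/

/-- Invariant of the moves: `M` splits the suffix, link 2 fits, the set of link 2 has the most
early chunks among the sets of at most its size, and no splitting that fits uses link 2 less. -/
structure MoveInv (C A : ℕ) (v₁ v₂ : ℕ → ℕ) (M : Finset ℕ × Finset ℕ) : Prop where
  disj : Disjoint M.1 M.2
  union : M.1 ∪ M.2 = Icc (A + 1) C
  fits : FitsIn C v₂ M.2
  dom : ∀ T ⊆ Icc (A + 1) C, FitsIn C v₂ T → #T ≤ #M.2 → ∀ i, cnt T i ≤ cnt M.2 i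
  least : ∀ T₁ T₂, Disjoint T₁ T₂ → T₁ ∪ T₂ = Icc (A + 1) C → FitsIn C v₁ T₁ → FitsIn C v₂ T₂ →
    #M.2 ≤ #T₂

theorem MoveInv.init (C A : ℕ) (v₁ v₂ : ℕ → ℕ) : MoveInv C A v₁ v₂ (Icc (A + 1) C, ∅) where
  disj := by simp
  union := by simp
  fits := fun i _ => by simp [cnt]
  dom := fun T _ _ h i => by
    have : T = ∅ := card_eq_zero.1 (by simpa using h)
    simp [this]
  least := by simp

/-- If `T₂` were no larger than `M.2`, dominance would give it at most as many chunks up to `i`. As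
both pairs split the same suffix, `T₁` would then overload link 1 at `i` as well. -/
theorem MoveInv.card_lt {C A : ℕ} {v₁ v₂ : ℕ → ℕ} {M : Finset ℕ × Finset ℕ}
    (hM : MoveInv C A v₁ v₂ M) {i : ℕ} (hi : i ∈ Icc 1 C) (hviol : v₁ i < cnt M.1 i)
    {T₁ T₂ : Finset ℕ} (hd : Disjoint T₁ T₂) (hu : T₁ ∪ T₂ = Icc (A + 1) C)
    (h₁ : FitsIn C v₁ T₁) (h₂ : FitsIn C v₂ T₂) : #M.2 < #T₂ := by
  by_contra hcon
  have h3 := hM.dom T₂ (hu ▸ subset_union_right) h₂ (by omega) i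
  have h4 := cnt_union hd i
  have h5 := cnt_union hM.disj i
  rw [hu] at h4
  rw [hM.union] at h5
  have h6 := h₁ i hi
  omega

/-- Dominance survives because the earliest admissible chunk is added (the exchange property
compares it with any rival set). Minimality survives because the overload proves that link 2 must
take one more chunk. -/
theorem MoveInv.step {C A : ℕ} {v₁ v₂ : ℕ → ℕ} {M : Finset ℕ × Finset ℕ}
    (hM : MoveInv C A v₁ v₂ M) {i : ℕ} (hi : i ∈ Icc 1 C) (hviol : v₁ i < cnt M.1 i) {m : ℕ}
    (hm : m ∈ M.1) (hfit : FitsIn C v₂ (insert m M.2))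
    (hmin : ∀ e ∈ M.1, FitsIn C v₂ (insert e M.2) → m ≤ e) :
    MoveInv C A v₁ v₂ (M.1.erase m, insert m M.2) := by
  have hm₂ : m ∉ M.2 := disjoint_left.1 hM.disj hm
  refine ⟨?_, ?_, hfit, ?_, ?_⟩
  · exact disjoint_insert_right.2 ⟨by simp, disjoint_of_subset_left (erase_subset _ _) hM.disj⟩
  · show M.1.erase m ∪ insert m M.2 = _
    rw [union_insert, ← insert_union, insert_erase hm, hM.union]
  · intro T hT hTf hTc j
    show cnt T j ≤ cnt (insert m M.2) j
    by_contra! hcon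
    have hTc' : #T ≤ #M.2 + 1 := by simpa [card_insert_of_notMem hm₂] using hTc
    have hMj : cnt M.2 j ≤ cnt (insert m M.2) j := cnt_mono_set (subset_insert _ _) j
    -- Otherwise the part of `T` up to `j` is small enough for the old dominance, which contradicts
    -- `hcon`.
    have hcases : cnt T j = #M.2 + 1 := by
      by_contra hne
      have h1 := cnt_le_card T j
      have h2 := hM.dom {x ∈ T | x ≤ j} ((filter_subset _ _).trans hT)
        (hTf.mono (filter_subset _ _)) (by unfold cnt at *; omega) j
      have h3 : cnt {x ∈ T | x ≤ j} j = cnt T j := by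
        unfold cnt; rw [filter_filter]; simp
      omega
    have hTle : ∀ x ∈ T, x ≤ j := by
      have h1 : #T ≤ #{x ∈ T | x ≤ j} := by unfold cnt at hcases; omega
      have h2 := eq_of_subset_of_card_le (filter_subset (fun x => x ≤ j) T) h1
      intro x hx
      rw [← h2] at hx
      exact (mem_filter.1 hx).2
    have hTcard : #T = #M.2 + 1 := by have := cnt_le_card T j; omega
    obtain ⟨x, hx⟩ : T.Nonempty := card_pos.1 (by omega)
    have herase : cnt (T.erase x) j = #M.2 := by
      unfold cnt
      rw [filter_true_of_mem fun y hy => hTle y (mem_of_mem_erase hy), card_erase_of_mem hx]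
      omega
    -- Dropping one element makes the old dominance applicable and puts all of `M.2` at or before
    -- `j`. The new chunk `m` is there too, since some `e ∈ T` is admissible and `m ≤ e ≤ j`.
    have h5 := hM.dom (T.erase x) ((erase_subset _ _).trans hT) (hTf.mono (erase_subset _ _))
      (by rw [card_erase_of_mem hx]; omega) j
    have h6 := cnt_insert hm₂ j
    obtain ⟨e, heT, heM, hef⟩ := hM.fits.augment hTf (by omega)
    have heM₁ : e ∈ M.1 := by
      have := hT heT
      rw [← hM.union, mem_union] at this
      exact this.resolve_right heM
    have h7 := hmin e heM₁ hef
    have h8 := hTle e heT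
    rw [if_pos (h7.trans h8)] at h6
    omega
  · intro T₁ T₂ hd hu h₁ h₂
    show #(insert m M.2) ≤ _
    rw [card_insert_of_notMem hm₂]
    exact hM.card_lt hi hviol hd hu h₁ h₂

/-- Link 1 fetches as many chunks as it can. -/
theorem MoveInv.card_fst_max {C A : ℕ} {v₁ v₂ : ℕ → ℕ} {M : Finset ℕ × Finset ℕ}
    (hM : MoveInv C A v₁ v₂ M) (hM₁ : FitsIn C v₁ M.1) {T : Finset ℕ} (hT : FitsIn C v₁ T)
    (hTC : T ⊆ Icc 1 C) (hTA : #T ≤ C - A) : #T ≤ #M.1 := by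
  by_contra! hcon
  -- `T` is replaced by a suffix so that the exchanged element lies in `Icc (A + 1) C`, hence in
  -- `M.2`. Moving it to link 1 contradicts `least`.
  have hsuf : FitsIn C v₁ (Icc (C - #T + 1) C) := fun i hi =>
    (cnt_suffix_le hTC le_rfl (mem_Icc.1 hi).2).trans (hT i hi)
  obtain ⟨e, heT, heM, hef⟩ := hM₁.augment hsuf (by rw [Nat.card_Icc]; omega)
  have he₂ : e ∈ M.2 := by
    have : e ∈ M.1 ∪ M.2 := by rw [hM.union]; simp at heT ⊢; omega
    exact (mem_union.1 this).resolve_left heM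
  have h1 := hM.least (insert e M.1) (M.2.erase e)
    (disjoint_insert_left.2 ⟨by simp, disjoint_of_subset_right (erase_subset _ _) hM.disj⟩)
    (by rw [insert_union, ← union_insert, insert_erase he₂, hM.union]) hef
    (hM.fits.mono (erase_subset _ _))
  rw [card_erase_of_mem he₂] at h1
  have : 0 < #M.2 := card_pos.2 ⟨e, he₂⟩
  omega

/-- Link 1 fetches its chunks as late as possible. -/
theorem MoveInv.cnt_fst_le {C A : ℕ} {v₁ v₂ : ℕ → ℕ} {M : Finset ℕ × Finset ℕ}
    (hM : MoveInv C A v₁ v₂ M) {T₁ T₂ : Finset ℕ} (hd : Disjoint T₁ T₂)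
    (hC : T₁ ∪ T₂ ⊆ Icc 1 C) (h₂ : FitsIn C v₂ T₂) (hc₁ : #T₁ = #M.1) (hc₂ : #T₂ = #M.2) (i : ℕ) :
    cnt M.1 i ≤ cnt T₁ i := by
  have hcard : #M.1 + #M.2 = C - A := by
    rw [← card_union_of_disjoint hM.disj, hM.union, Nat.card_Icc]; omega
  -- Dominance only concerns subsets of the suffix, so the competitor is first shifted into it.
  obtain ⟨U₁, U₂, hUd, hU, hU₁, hU₂, hUc₁, hUc₂⟩ := exists_shift (A := A) hd hC (by omega)
  have h1 := hM.dom U₂ (hU ▸ subset_union_right) (fun j hj => (hUc₂ j).trans (h₂ j hj))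
    (by omega) i
  have h2 := cnt_union hUd i
  have h3 := cnt_union hM.disj i
  rw [hU] at h2
  rw [hM.union] at h3
  have := hUc₁ i
  omega

/-! ### Cumulative bandwidth and the number of layers it carries -/

namespace Instance

variable (P : Instance)

/-- Bandwidth of the profile `b` up to the deadline of chunk `i`. -/
def cum (b : ℕ → ℝ) (i : ℕ) : ℝ := ∑ j ∈ Icc 1 (P.deadline i), b j

theorem deadline_mono : Monotone P.deadline := by
  intro i j h
  unfold deadline
  gcongr

theorem Y_pos {n : ℕ} (hn : n ≤ P.N) : 0 < P.Y n :=
  mul_pos (by exact_mod_cast P.L_pos) (P.r_pos n hn)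

theorem cum_mono {b : ℕ → ℝ} (hb : ∀ j, 0 ≤ b j) : Monotone (P.cum b) := by
  intro i j h
  exact sum_le_sum_of_subset_of_nonneg (Icc_subset_Icc_right (P.deadline_mono h))
    fun k _ _ => hb k

theorem cum_nonneg {b : ℕ → ℝ} (hb : ∀ j, 0 ≤ b j) (i : ℕ) : 0 ≤ P.cum b i :=
  sum_nonneg fun k _ => hb k

theorem V_mono {n : ℕ} (hn : n ≤ P.N) {b : ℕ → ℝ} (hb : ∀ j, 0 ≤ b j) : Monotone (P.V n b) := by
  intro i j h
  exact Nat.floor_le_floor (div_le_div_of_nonneg_right (P.cum_mono hb h) (P.Y_pos hn).le)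

/-- Translates between the integer counts of the scans and the real amounts of the fetching. -/
theorem le_V_iff {n : ℕ} (hn : n ≤ P.N) {b : ℕ → ℝ} (hb : ∀ j, 0 ≤ b j) (i c : ℕ) :
    c ≤ P.V n b i ↔ P.Y n * c ≤ P.cum b i := by
  change c ≤ ⌊P.cum b i / P.Y n⌋₊ ↔ _
  rw [Nat.le_floor_iff (div_nonneg (P.cum_nonneg hb i) (P.Y_pos hn).le),
    le_div_iff₀ (P.Y_pos hn), mul_comm]

theorem V_zero (n i : ℕ) : P.V n 0 i = 0 := by simp [V]

/-! ### Forward scan -/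

theorem skip_le (n : ℕ) (B : Link → ℕ → ℝ) (cand : Finset ℕ) (i : ℕ) : P.skip n B cand i ≤ i := by
  induction i with
  | zero => simp [skip]
  | succ i ih => rw [skip]; split_ifs <;> omega

theorem skip_mono (n : ℕ) (B : Link → ℕ → ℝ) (cand : Finset ℕ) : Monotone (P.skip n B cand) := by
  refine monotone_nat_of_le_succ fun i => ?_
  rw [skip]; split_ifs <;> omega

/-- After the skips the remaining chunks can be carried. -/
theorem le_V_add_skip {n : ℕ} (hn : n ≤ P.N) {B : Link → ℕ → ℝ} (hB : ∀ k j, 0 ≤ B k j)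
    (cand : Finset ℕ) (i : ℕ) :
    i ≤ P.V n (B .one) i + P.V n (B .two) i + P.skip n B cand i := by
  induction i with
  | zero => simp
  | succ i ih =>
    have h₁ := P.V_mono hn (hB .one) (Nat.le_succ i)
    have h₂ := P.V_mono hn (hB .two) (Nat.le_succ i)
    rw [skip]
    split_ifs <;> simp only [Nat.succ_eq_add_one] at * <;> omega

theorem le_skip {n : ℕ} {B : Link → ℕ → ℝ} {C A : ℕ} {i : ℕ} (hi : i ≤ A) :
    P.skip n B (Icc (A + 1) C) i = i := by
  induction i with
  | zero => rfl
  | succ i ih =>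
    rw [skip, if_pos (by simp; omega), ih (by omega)]

/-- The skips are unavoidable. -/
theorem skip_tight (n : ℕ) (B : Link → ℕ → ℝ) (C A : ℕ) {i : ℕ} (hi : i ≤ C) :
    P.skip n B (Icc (A + 1) C) i ≤ A ∨ ∃ i' ∈ Icc 1 i,
      P.V n (B .one) i' + P.V n (B .two) i' + P.skip n B (Icc (A + 1) C) i ≤ i' := by
  induction i with
  | zero => simp [skip]
  | succ i ih =>
    by_cases hA : i + 1 ≤ A
    · exact Or.inl (by rw [P.le_skip hA]; exact hA)
    rw [skip]
    split_ifs with h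
    · have h' := h.resolve_right (by simp; omega)
      exact Or.inr ⟨i + 1, by simp, by omega⟩
    · rcases ih (by omega) with h1 | ⟨i', hi', h1⟩
      · exact Or.inl h1
      · exact Or.inr ⟨i', by simp at hi' ⊢; omega, h1⟩

/-- At the deadline given by `skip_tight`, bandwidth limits the chunks before it and `C - i` limits
those after it. -/
theorem card_le_sub_skip {n : ℕ} {B : Link → ℕ → ℝ} {A : ℕ} {T : Finset ℕ} (hT : T ⊆ Icc 1 P.C)
    (hTA : #T ≤ P.C - A)
    (hfit : ∀ i ∈ Icc 1 P.C, cnt T i ≤ P.V n (B .one) i + P.V n (B .two) i) :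
    #T ≤ P.C - P.skip n B (Icc (A + 1) P.C) P.C := by
  rcases P.skip_tight n B P.C A le_rfl with h | ⟨i, hi, h⟩
  · omega
  · have h1 := hfit i hi
    have h2 := card_le_cnt_add hT (mem_Icc.1 hi).2
    have := mem_Icc.1 hi
    omega

/-! ### Moves -/

theorem fits_iff (B : Link → ℕ → ℝ) (S : Finset ℕ) :
    P.Fits B S ↔ FitsIn P.C (P.V 0 (B .two)) S := Iff.rfl

variable {P} in
theorem moveInv_moveStep {B : Link → ℕ → ℝ} {A i : ℕ} (hi : i ∈ Icc 1 P.C)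
    {M : Finset ℕ × Finset ℕ} (hM : MoveInv P.C A (P.V 0 (B .one)) (P.V 0 (B .two)) M) :
    MoveInv P.C A (P.V 0 (B .one)) (P.V 0 (B .two)) (P.moveStep B i M) ∧
      (P.moveStep B i M).1 ⊆ M.1 := by
  classical
  unfold moveStep
  split_ifs with h
  · have hmem := mem_filter.1 (min'_mem _ h.2)
    refine ⟨hM.step hi h.1 hmem.1 ((P.fits_iff B _).1 ?_) fun e he hef => ?_, erase_subset _ _⟩
    · convert hmem.2
    · exact min'_le _ _ (mem_filter.2 ⟨he, hef⟩)
  · exact ⟨hM, Subset.rfl⟩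

variable {P} in
-- As long as some splitting fits, an overload of link 1 always allows a move: `MoveInv.card_lt` and
-- the exchange property provide an admissible chunk.
theorem card_moveStep {B : Link → ℕ → ℝ} {A i : ℕ} (hi : i ∈ Icc 1 P.C)
    {M : Finset ℕ × Finset ℕ} (hM : MoveInv P.C A (P.V 0 (B .one)) (P.V 0 (B .two)) M)
    {T₁ T₂ : Finset ℕ} (hd : Disjoint T₁ T₂) (hu : T₁ ∪ T₂ = Icc (A + 1) P.C)
    (h₁ : FitsIn P.C (P.V 0 (B .one)) T₁) (h₂ : FitsIn P.C (P.V 0 (B .two)) T₂)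
    (hviol : P.V 0 (B .one) i < cnt M.1 i) : #(P.moveStep B i M).1 + 1 = #M.1 := by
  classical
  have hex : {m ∈ M.1 | P.Fits B (insert m M.2)}.Nonempty := by
    obtain ⟨e, heT, heM, hef⟩ := hM.fits.augment h₂ (hM.card_lt hi hviol hd hu h₁ h₂)
    refine ⟨e, mem_filter.2 ⟨?_, hef⟩⟩
    have : e ∈ M.1 ∪ M.2 := by rw [hM.union, ← hu]; exact mem_union_right _ heT
    exact (mem_union.1 this).resolve_right heM
  unfold moveStep
  rw [dif_pos ⟨hviol, by convert hex⟩]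
  apply card_erase_add_one
  exact (mem_filter.1 (min'_mem _ _)).1

variable {P} in
-- Each iteration either finds the overload at `i` removed or shrinks `M.1` by one. Overloads that
-- are removed stay removed because `M.1` never grows.
theorem moveInv_iterate {B : Link → ℕ → ℝ} {A i : ℕ} (hi : i ∈ Icc 1 P.C)
    {M : Finset ℕ × Finset ℕ} (hM : MoveInv P.C A (P.V 0 (B .one)) (P.V 0 (B .two)) M)
    {T₁ T₂ : Finset ℕ} (hd : Disjoint T₁ T₂) (hu : T₁ ∪ T₂ = Icc (A + 1) P.C)
    (h₁ : FitsIn P.C (P.V 0 (B .one)) T₁) (h₂ : FitsIn P.C (P.V 0 (B .two)) T₂) (q : ℕ) :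
    MoveInv P.C A (P.V 0 (B .one)) (P.V 0 (B .two)) ((P.moveStep B i)^[q] M) ∧
      ((P.moveStep B i)^[q] M).1 ⊆ M.1 ∧
      (cnt ((P.moveStep B i)^[q] M).1 i ≤ P.V 0 (B .one) i ∨
        #((P.moveStep B i)^[q] M).1 + q ≤ #M.1) := by
  induction q with
  | zero => exact ⟨hM, Subset.rfl, Or.inr (by simp)⟩
  | succ q ih =>
    rw [Function.iterate_succ_apply']
    obtain ⟨h1, h2, h3⟩ := ih
    obtain ⟨h4, h5⟩ := moveInv_moveStep hi h1
    refine ⟨h4, h5.trans h2, ?_⟩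
    by_cases hv : cnt ((P.moveStep B i)^[q] M).1 i ≤ P.V 0 (B .one) i
    · exact Or.inl ((cnt_mono_set h5 i).trans hv)
    · have := card_moveStep hi h1 hd hu h₁ h₂ (not_le.1 hv)
      right
      have := h3.resolve_left hv
      omega

variable {P} in
theorem moveInv_moves {B : Link → ℕ → ℝ} (hB : ∀ k j, 0 ≤ B k j) {A : ℕ}
    (hA : ∀ i ∈ Icc 1 P.C, i ≤ P.V 0 (B .one) i + P.V 0 (B .two) i + A) :
    MoveInv P.C A (P.V 0 (B .one)) (P.V 0 (B .two)) (P.moves B A) ∧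
      FitsIn P.C (P.V 0 (B .one)) (P.moves B A).1 := by
  obtain ⟨T₁, T₂, hd, hu, h₁, h₂⟩ := exists_split (P.V_mono (Nat.zero_le _) (hB .one))
    (P.V_mono (Nat.zero_le _) (hB .two)) hA
  have key : ∀ l : List ℕ, (∀ i ∈ l, i ∈ Icc 1 P.C) → ∀ M,
      M = l.foldl (fun M i => (P.moveStep B i)^[P.C] M) (Icc (A + 1) P.C, ∅) →
      MoveInv P.C A (P.V 0 (B .one)) (P.V 0 (B .two)) M ∧
        ∀ i ∈ l, cnt M.1 i ≤ P.V 0 (B .one) i := by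
    intro l
    induction l using List.reverseRecOn with
    | nil => rintro - M rfl; exact ⟨MoveInv.init _ _ _ _, by simp⟩
    | append_singleton l i ih =>
      rintro hl M rfl
      obtain ⟨h3, h4⟩ := ih (fun j hj => hl j (by simp [hj])) _ rfl
      rw [List.foldl_append, List.foldl_cons, List.foldl_nil]
      obtain ⟨h5, h6, h7⟩ := moveInv_iterate (hl i (by simp)) h3 hd hu h₁ h₂ P.C
      refine ⟨h5, fun j hj => ?_⟩
      rcases List.mem_append.1 hj with hj | hj
      · exact (cnt_mono_set h6 j).trans (h4 j hj)
      · obtain rfl := List.mem_singleton.1 hj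
        refine h7.elim id fun h8 => ?_
        -- After `C` effective moves `M.1`, which has at most `C - A` elements, would be empty and
        -- nothing could be overloaded.
        have h9 := card_le_card (subset_union_left.trans h3.union.subset)
        rw [Nat.card_Icc] at h9
        have h10 := cnt_le_card ((P.moveStep B j)^[P.C] (l.foldl
          (fun M i => (P.moveStep B i)^[P.C] M) (Icc (A + 1) P.C, ∅))).1 j
        omega
  obtain ⟨h3, h4⟩ := key (List.range' 1 P.C) (by intro i hi; simp at hi ⊢; omega) _ rfl
  exact ⟨h3, fun i hi => h4 i (by simp at hi ⊢; omega)⟩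

end Instance

/-! ### Backward scan -/

theorem sum_Icc_one_update (b : ℕ → ℝ) {i m : ℕ} (h : i < m) (x : ℝ) :
    ∑ j ∈ Icc 1 i, Function.update b m x j = ∑ j ∈ Icc 1 i, b j :=
  sum_congr rfl fun j hj => Function.update_of_ne (by simp at hj; omega) _ _

/-- Gives the disallowed link infinite cost, so the comparison of costs picks the allowed one. -/
theorem backward_zero_profile (t : ℤ) (j : ℕ) {y : ℝ} (hy : 0 < y) :
    (backward t j y 0).2 = ⊤ := by
  induction j with
  | zero => simp [backward, hy]
  | succ j ih =>
    have h0 : min 0 y = 0 := min_eq_left hy.le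
    have h1 : Function.update (0 : ℕ → ℝ) (j + 1) 0 = 0 := by
      simp
    rw [backward, if_pos hy]
    simp only [Pi.zero_apply, h0, sub_zero, h1, ih, WithTop.add_top]

/-- The backward scan fetches the amount `y`, as late as possible. -/
structure BackwardSpec (j : ℕ) (y : ℝ) (b b' : ℕ → ℝ) : Prop where
  nonneg : ∀ i, 0 ≤ b' i
  le : ∀ i, b' i ≤ b i
  outside : ∀ i, i ∉ Icc 1 j → b' i = b i
  amount : ∑ i ∈ Icc 1 j, b' i = ∑ i ∈ Icc 1 j, b i - y
  latest : ∀ i ≤ j, ∑ k ∈ Icc 1 i, b' k = ∑ k ∈ Icc 1 i, b k ∨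
    ∑ k ∈ Icc 1 i, b' k = ∑ k ∈ Icc 1 j, b' k

theorem backward_spec (t : ℤ) (j : ℕ) {y : ℝ} {b : ℕ → ℝ} (hb : ∀ i, 0 ≤ b i) (hy : 0 ≤ y)
    (hyb : y ≤ ∑ i ∈ Icc 1 j, b i) :
    BackwardSpec j y b (backward t j y b).1 ∧ (backward t j y b).2 ≠ ⊤ := by
  induction j generalizing y b with
  | zero =>
    have h0 : y = 0 := le_antisymm (by simpa using hyb) hy
    subst h0
    refine ⟨⟨hb, fun _ => le_rfl, fun _ _ => rfl, by simp [backward], ?_⟩, by simp [backward]⟩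
    intro i _
    exact Or.inl rfl
  | succ j ih =>
    rcases hy.eq_or_lt with rfl | hy'
    · have h1 : backward t (j + 1) 0 b = (b, 0) := by simp [backward]
      rw [h1]
      exact ⟨⟨hb, fun _ => le_rfl, fun _ _ => rfl, by simp, fun i _ => Or.inl rfl⟩, by simp⟩
    rw [backward, if_pos hy']
    set f := min (b (j + 1)) y with hf
    set b₁ := Function.update b (j + 1) (b (j + 1) - f) with hb₁
    have hb₁0 : ∀ i, 0 ≤ b₁ i := by
      intro i
      rcases eq_or_ne i (j + 1) with rfl | hne
      · simp [hb₁, hf]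
      · simpa [hb₁, hne] using hb i
    have hb₁le : ∀ i, b₁ i ≤ b i := by
      intro i
      rcases eq_or_ne i (j + 1) with rfl | hne
      · simp [hb₁, hf, hb, hy]
      · simp [hb₁, hne]
    have hs : ∀ i ≤ j, ∑ k ∈ Icc 1 i, b₁ k = ∑ k ∈ Icc 1 i, b k := fun i hi =>
      sum_Icc_one_update b (by omega) _
    have hsj : ∀ g : ℕ → ℝ, ∑ k ∈ Icc 1 (j + 1), g k = ∑ k ∈ Icc 1 j, g k + g (j + 1) := fun g =>
      sum_Icc_succ_top (by omega) g
    have hrest : y - f ≤ ∑ i ∈ Icc 1 j, b₁ i := by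
      rw [hs j le_rfl]
      rw [hsj] at hyb
      rcases min_choice (b (j + 1)) y with h | h
      · rw [hf, h]; linarith
      · rw [hf, h, sub_self]; exact sum_nonneg fun i _ => hb i
    obtain ⟨h, htop⟩ := ih hb₁0 (by rw [hf]; linarith [min_le_right (b (j + 1)) y]) hrest
    have hout : (backward t j (y - f) b₁).1 (j + 1) = b (j + 1) - f := by
      rw [h.outside _ (by simp)]; simp [hb₁]
    refine ⟨⟨h.nonneg, fun i => (h.le i).trans (hb₁le i), fun i hi => ?_, ?_, fun i hi => ?_⟩, ?_⟩
    · rw [h.outside i (by simp at hi ⊢; omega)]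
      simp [hb₁, show i ≠ j + 1 by rintro rfl; simp at hi]
    · rw [hsj, hsj, h.amount, hs j le_rfl, hout]; ring
    · rcases hi.eq_or_lt with rfl | hi'
      · exact Or.inr rfl
      · simp only
        rw [hsj, hout]
        -- Either the slot is exhausted and adds nothing to the residual sum, or the demand is met
        -- there and earlier slots stay untouched.
        rcases min_choice (b (j + 1)) y with hm | hm
        · refine (h.latest i (by omega)).imp (fun e => e.trans (hs i (by omega))) fun e => ?_
          have hbf : b (j + 1) - f = 0 := by rw [hf, hm, sub_self]
          rw [e, ← hb₁, hbf, add_zero]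
        · left
          have h0 : y - f = 0 := by rw [hf, hm, sub_self]
          rw [← hs i (by omega)]
          refine sum_congr rfl fun k hk => ?_
          have hkj : k ∈ Icc 1 j := by simp at hk ⊢; omega
          have h1 : ∑ k ∈ Icc 1 j, (backward t j (y - f) b₁).1 k = ∑ k ∈ Icc 1 j, b₁ k := by
            rw [h.amount, h0, sub_zero]
          exact (sum_eq_sum_iff_of_le fun i _ => h.le i).1 h1 k hkj
    · rw [hb₁] at htop
      simp only [ne_eq, WithTop.add_eq_top, htop, or_false]
      split_ifs <;> simp

/-! ### Backward pass over the chunks of a layer -/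

/-- Properties of the state `σ` during the backward pass for layer `n` that starts with the
bandwidth profiles `B`. -/
structure Fetched (P : Instance) (n : ℕ) (B : Link → ℕ → ℝ) (σ : State) : Prop where
  nonneg : ∀ k j, 0 ≤ σ.B k j
  sub : ∀ k, σ.I k ⊆ Icc 1 P.C
  lower : ∀ k, ∀ i ∈ Icc 1 P.C, ∃ i' ∈ Icc i P.C,
    P.cum (B k) i' - P.Y n * cnt (σ.I k) i' ≤ P.cum (σ.B k) i
  plan : ∃ z : Link → ℕ → ℕ → ℝ, (∀ k i j, 0 ≤ z k i j) ∧
    (∀ k i j, i ∉ σ.I k ∨ j ∉ Icc 1 (P.deadline i) → z k i j = 0) ∧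
    (∀ k, ∀ i ∈ σ.I k, ∑ j ∈ Icc 1 (P.deadline i), z k i j = P.Y n) ∧
    ∀ k j, σ.B k j + ∑ i ∈ Icc 1 P.C, z k i j = B k j

variable {P : Instance}

theorem Fetched.init {n : ℕ} {B : Link → ℕ → ℝ} (hB : ∀ k j, 0 ≤ B k j) :
    Fetched P n B ⟨B, fun _ => ∅⟩ where
  nonneg := hB
  sub := by simp
  lower := fun k i hi => ⟨i, by simp at hi ⊢; omega, by simp [cnt]⟩
  plan := ⟨0, by simp, by simp, by simp, by simp⟩

/-- If link `k` has enough bandwidth, then the layer is fetched over it. -/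
theorem fetchStep_eq {n : ℕ} (hn : n ≤ P.N) {σ : State} (hσ : ∀ k j, 0 ≤ σ.B k j) {k : Link}
    {i : ℕ} (h : P.Y n ≤ P.cum (σ.B k) i) :
    ∃ b', BackwardSpec (P.deadline i) (P.Y n) (σ.B k) b' ∧
      P.fetchStep n k i σ = ⟨Function.update σ.B k b',
        Function.update σ.I k (insert i (σ.I k))⟩ := by
  have hY := P.Y_pos hn
  obtain ⟨h1, h2⟩ := backward_spec (((i : ℤ) - 2) * P.L + P.s) (P.deadline i) (hσ k) hY.le h
  refine ⟨_, h1, ?_⟩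
  have h3 := backward_zero_profile (((i : ℤ) - 2) * P.L + P.s) (P.deadline i) hY
  unfold Instance.fetchStep
  cases k with
  | one => simp [h3]
  | two => simp [h3, h2]

/-- The bound `lower` together with `hfit` ensures that chunk `i` can be fetched. Afterwards a
deadline from `i` on loses exactly one layer size. An earlier one is either unaffected or has the
same residual as deadline `i`, whose witness it inherits. -/
theorem Fetched.step {n : ℕ} (hn : n ≤ P.N) {B : Link → ℕ → ℝ} {σ : State}
    (hσ : Fetched P n B σ) {k : Link} {i : ℕ} (hi : i ∈ Icc 1 P.C) (hik : i ∉ σ.I k)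
    (hfit : ∀ i' ∈ Icc 1 P.C, P.Y n * cnt (insert i (σ.I k)) i' ≤ P.cum (B k) i') :
    Fetched P n B (P.fetchStep n k i σ) ∧
      (P.fetchStep n k i σ).I = Function.update σ.I k (insert i (σ.I k)) := by
  have hY := P.Y_pos hn
  have hen : P.Y n ≤ P.cum (σ.B k) i := by
    obtain ⟨i', hi', h1⟩ := hσ.lower k i hi
    have h2 := hfit i' (by simp at hi hi' ⊢; omega)
    rw [cnt_insert hik, if_pos (mem_Icc.1 hi').1] at h2
    push_cast at h2
    linarith
  obtain ⟨b', hb', heq⟩ := fetchStep_eq hn hσ.nonneg hen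
  rw [heq]
  refine ⟨⟨?_, ?_, ?_, ?_⟩, rfl⟩
  · intro k' j
    rcases eq_or_ne k' k with rfl | hk
    · simpa using hb'.nonneg j
    · simpa [hk] using hσ.nonneg k' j
  · intro k'
    rcases eq_or_ne k' k with rfl | hk
    · simpa [insert_subset_iff] using ⟨mem_Icc.1 hi, hσ.sub k'⟩
    · simpa [hk] using hσ.sub k'
  · intro k' m hm
    rcases eq_or_ne k' k with rfl | hk
    · simp only [Function.update_self]
      have late : ∀ m ∈ Icc 1 P.C, i ≤ m → ∃ m' ∈ Icc m P.C,
          P.cum (B k') m' - P.Y n * cnt (insert i (σ.I k')) m' ≤ P.cum b' m := by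
        intro m hm him
        obtain ⟨m', hm', h1⟩ := hσ.lower k' m hm
        refine ⟨m', hm', ?_⟩
        rw [cnt_insert hik, if_pos (him.trans (mem_Icc.1 hm').1)]
        have h2 : P.cum b' m = P.cum (σ.B k') m - P.Y n := by
          have h3 : Icc 1 (P.deadline i) ⊆ Icc 1 (P.deadline m) :=
            Icc_subset_Icc_right (P.deadline_mono him)
          unfold Instance.cum
          rw [← sum_sdiff h3, ← sum_sdiff h3 (f := σ.B k'), hb'.amount,
            sum_congr rfl fun j hj => hb'.outside j (mem_sdiff.1 hj).2]
          ring
        push_cast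
        linarith
      rcases Nat.lt_or_ge m i with hmi | hmi
      · rcases hb'.latest (P.deadline m) (P.deadline_mono hmi.le) with h | h
        · obtain ⟨m', hm', h1⟩ := hσ.lower k' m hm
          refine ⟨m', hm', ?_⟩
          have h2 : P.cum b' m = P.cum (σ.B k') m := h
          rw [h2]
          refine le_trans ?_ h1
          gcongr
          exact cnt_mono_set (subset_insert _ _) _
        · obtain ⟨m', hm', h1⟩ := late i hi le_rfl
          refine ⟨m', by simp at hm' ⊢; omega, h1.trans_eq h.symm⟩
      · exact late m hm hmi
    · simpa [hk] using hσ.lower k' m hm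
  · obtain ⟨z, hz0, hzout, hzamt, hzsum⟩ := hσ.plan
    refine ⟨Function.update z k (Function.update (z k) i fun j => σ.B k j - b' j), ?_, ?_, ?_, ?_⟩
    · intro k' m j
      rcases eq_or_ne k' k with rfl | hk
      · rcases eq_or_ne m i with rfl | hmi
        · simpa using hb'.le j
        · simpa [hmi] using hz0 k' m j
      · simpa [hk] using hz0 k' m j
    · intro k' m j h
      rcases eq_or_ne k' k with rfl | hk
      · rcases eq_or_ne m i with rfl | hmi
        · have : j ∉ Icc 1 (P.deadline m) := by simpa using h
          simp [hb'.outside j this]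
        · simp only [Function.update_self, mem_insert, hmi, false_or] at h
          simpa [hmi] using hzout k' m j h
      · simp only [Function.update_of_ne hk] at h ⊢
        exact hzout k' m j h
    · intro k' m hm
      rcases eq_or_ne k' k with rfl | hk
      · rcases eq_or_ne m i with rfl | hmi
        · simp [hb'.amount]
        · simp only [Function.update_self, mem_insert, hmi, false_or] at hm
          simpa [hmi] using hzamt k' m hm
      · simp only [Function.update_of_ne hk] at hm ⊢
        exact hzamt k' m hm
    · intro k' j
      rcases eq_or_ne k' k with rfl | hk
      · have h1 := hzsum k' j
        have h2 : z k' i j = 0 := hzout k' i j (Or.inl hik)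
        rw [← add_sum_erase _ _ hi] at h1 ⊢
        rw [sum_congr rfl fun m hm => by
          rw [Function.update_self, Function.update_of_ne (ne_of_mem_erase hm)]]
        simp only [Function.update_self]
        linarith
      · simpa [hk] using hzsum k' j

/-- It is enough that the final sets fit, since the sets at intermediate stages are contained in
them. -/
theorem Fetched.fetchAll {n : ℕ} (hn : n ≤ P.N) {B : Link → ℕ → ℝ} (hB : ∀ k j, 0 ≤ B k j)
    {A : ℕ} {cand : Finset ℕ} (hcand : Icc (A + 1) P.C ⊆ cand)
    {allowed : ℕ → Link}
    (hfit : ∀ k, ∀ i ∈ Icc 1 P.C,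
      P.Y n * cnt {m ∈ Icc (A + 1) P.C | allowed m = k} i ≤ P.cum (B k) i) :
    Fetched P n B (P.fetchAll n A cand allowed B) ∧
      ∀ k, (P.fetchAll n A cand allowed B).I k = {m ∈ Icc (A + 1) P.C | allowed m = k} := by
  have hY := P.Y_pos hn
  have key : ∀ l : List ℕ, l.Nodup → (∀ i ∈ l, i ∈ Icc (A + 1) P.C) → ∀ σ,
      σ = l.foldl (fun σ i => if i ∈ cand then P.fetchStep n (allowed i) i σ else σ)
        ⟨B, fun _ => ∅⟩ →
      Fetched P n B σ ∧ ∀ k, σ.I k = {m ∈ l.toFinset | allowed m = k} := by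
    intro l
    induction l using List.reverseRecOn with
    | nil => rintro - - σ rfl; exact ⟨Fetched.init hB, by simp⟩
    | append_singleton l i ih =>
      rintro hnd hl σ rfl
      rw [List.nodup_append] at hnd
      obtain ⟨h1, h2⟩ := ih hnd.1 (fun j hj => hl j (by simp [hj])) _ rfl
      rw [List.foldl_append, List.foldl_cons, List.foldl_nil]
      set τ := l.foldl (fun σ i => if i ∈ cand then P.fetchStep n (allowed i) i σ else σ)
        ⟨B, fun _ => ∅⟩
      have hiA := hl i (by simp)
      have hil : i ∉ l := fun h => hnd.2.2 i h i (by simp) rfl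
      rw [if_pos (hcand hiA)]
      obtain ⟨h3, h4⟩ := h1.step hn (k := allowed i) (i := i) (by simp at hiA ⊢; omega)
        (by rw [h2]; simp [hil]) (fun i' hi' => by
          refine le_trans ?_ (hfit (allowed i) i' hi')
          gcongr
          apply cnt_mono_set
          rw [h2]
          intro m hm
          rw [mem_insert, mem_filter, List.mem_toFinset] at hm
          rw [mem_filter]
          rcases hm with rfl | hm
          · exact ⟨hiA, rfl⟩
          · exact ⟨hl m (by simp [hm.1]), hm.2⟩)
      refine ⟨h3, fun k => ?_⟩
      rw [h4]
      rcases eq_or_ne k (allowed i) with rfl | hk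
      · rw [Function.update_self, h2]
        ext m
        simp only [mem_insert, mem_filter, List.mem_toFinset, List.mem_append, List.mem_singleton]
        constructor
        · rintro (rfl | h)
          · simp
          · exact ⟨Or.inl h.1, h.2⟩
        · rintro ⟨h | h, h'⟩
          · exact Or.inr ⟨h, h'⟩
          · exact Or.inl h
      · rw [Function.update_of_ne hk, h2]
        ext m
        simp only [mem_filter, List.mem_toFinset, List.mem_append, List.mem_singleton]
        constructor
        · rintro h; exact ⟨Or.inl h.1, h.2⟩
        · rintro ⟨h | rfl, h'⟩
          · exact ⟨h, h'⟩
          · exact absurd h'.symm hk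
  have hmem : ∀ i, i ∈ List.range' (A + 1) (P.C - A) ↔ i ∈ Icc (A + 1) P.C := by
    intro i; simp; omega
  obtain ⟨h1, h2⟩ := key (List.range' (A + 1) (P.C - A)) List.nodup_range'
    (fun i hi => (hmem i).1 hi) _ rfl
  refine ⟨h1, fun k => (h2 k).trans ?_⟩
  congr 1
  ext i
  rw [List.mem_toFinset, hmem]

/-! ### Outcome of each layer -/

namespace Instance

/-- Bandwidth profiles at the start of the processing of layer `n`. -/
noncomputable def residual (P : Instance) : ℕ → Link → ℕ → ℝ
  | 0 => P.B
  | n + 1 => (P.run n).B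

theorem baseRun_spec (P : Instance) :
    ∃ A ≤ P.C, Fetched P 0 P.B (P.run 0) ∧
      MoveInv P.C A (P.V 0 (P.B .one)) (P.V 0 (P.B .two)) ((P.run 0).I .one, (P.run 0).I .two) ∧
      FitsIn P.C (P.V 0 (P.B .one)) ((P.run 0).I .one) ∧
      ∀ T ⊆ Icc 1 P.C, (∀ i ∈ Icc 1 P.C, cnt T i ≤ P.V 0 (P.B .one) i + P.V 0 (P.B .two) i) →
        #T ≤ P.C - A := by
  set A := P.skip 0 P.B (Icc 1 P.C) P.C with hA
  have hskip : ∀ i ∈ Icc 1 P.C, i ≤ P.V 0 (P.B .one) i + P.V 0 (P.B .two) i + A := fun i hi =>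
    (P.le_V_add_skip (Nat.zero_le _) P.B_nonneg (Icc 1 P.C) i).trans
      (Nat.add_le_add_left (P.skip_mono _ _ _ (mem_Icc.1 hi).2) _)
  obtain ⟨hM, hM₁⟩ := moveInv_moves P.B_nonneg hskip
  set M := P.moves P.B A with hMdef
  have hlink : ∀ k, {m ∈ Icc (A + 1) P.C | (if m ∈ M.1 then Link.one else Link.two) = k} =
      match k with
      | .one => M.1
      | .two => M.2 := by
    intro k
    ext m
    rw [mem_filter, ← hM.union, mem_union]
    have : m ∈ M.1 → m ∉ M.2 := fun h => disjoint_left.1 hM.disj h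
    cases k <;> by_cases hm : m ∈ M.1 <;> simp [hm, this]
  obtain ⟨h1, h2⟩ := Fetched.fetchAll (P := P) (n := 0) (Nat.zero_le _) P.B_nonneg (A := A)
    (cand := Icc 1 P.C) (Icc_subset_Icc_left (by omega))
    (allowed := fun i => if i ∈ M.1 then .one else .two) (by
      intro k i hi
      rw [hlink, ← P.le_V_iff (Nat.zero_le _) (P.B_nonneg k)]
      cases k
      · exact hM₁ i hi
      · exact hM.fits i hi)
  have h3 : P.run 0 = P.fetchAll 0 A (Icc 1 P.C)
    (fun i => if i ∈ M.1 then .one else .two) P.B := rfl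
  rw [h3]
  have h4 := (h2 .one).trans (hlink .one)
  have h5 := (h2 .two).trans (hlink .two)
  refine ⟨A, P.skip_le _ _ _ _, h1, ?_, ?_, fun T hT hfit => ?_⟩
  · rw [h4, h5]; exact hM
  · rw [h4]; exact hM₁
  · have h6 : #T ≤ P.C - 0 := by simpa using card_le_card hT
    exact P.card_le_sub_skip hT h6 hfit

/-- With link 2 switched off, no splitting is needed: the suffix left by the forward scan fits on
link 1. Thus the candidates of every enhancement layer are again a suffix. -/
theorem enhRun_spec {n : ℕ} (hn : n ≤ P.N) {σ : State} (hσ : ∀ k j, 0 ≤ σ.B k j) {A : ℕ}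
    (hA : A ≤ P.C) (hcand : σ.I .one ∪ σ.I .two = Icc (A + 1) P.C) :
    ∃ A', A ≤ A' ∧ A' ≤ P.C ∧ Fetched P n σ.B (P.enhRun n σ) ∧
      (P.enhRun n σ).I .one = Icc (A' + 1) P.C ∧ (P.enhRun n σ).I .two = ∅ ∧
      ∀ T ⊆ Icc 1 P.C, #T ≤ P.C - A →
        (∀ i ∈ Icc 1 P.C, P.Y n * cnt T i ≤ P.cum (σ.B .one) i) → #T ≤ P.C - A' := by
  set B := Function.update σ.B .two 0 with hB
  have hB0 : ∀ k j, 0 ≤ B k j := by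
    intro k j
    cases k
    · simpa [hB] using hσ .one j
    · simp [hB]
  set A' := P.skip n B (Icc (A + 1) P.C) P.C with hA'
  have hAA' : A ≤ A' := (P.le_skip (n := n) (B := B) (C := P.C) (le_refl A)).symm.le.trans
    (P.skip_mono _ _ _ hA)
  have hskip : ∀ i ∈ Icc 1 P.C, i ≤ P.V n (σ.B .one) i + A' := fun i hi => by
    have h1 := P.le_V_add_skip hn hB0 (Icc (A + 1) P.C) i
    have h2 : B .two = 0 := by simp [hB]
    have h3 : B .one = σ.B .one := by simp [hB]
    rw [h2, h3, V_zero, add_zero] at h1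
    exact h1.trans (Nat.add_le_add_left (P.skip_mono _ _ _ (mem_Icc.1 hi).2) _)
  obtain ⟨h1, h2⟩ := Fetched.fetchAll (P := P) (n := n) hn hσ (A := A')
    (cand := Icc (A + 1) P.C) (Icc_subset_Icc_left (by omega))
    (allowed := fun _ => .one) (by
      intro k i hi
      cases k
      · simp only [filter_true]
        rw [← P.le_V_iff hn (hσ .one), cnt_Icc]
        have := hskip i hi
        omega
      · simpa [cnt] using P.cum_nonneg (hσ .two) i)
  have h3 : P.enhRun n σ = P.fetchAll n A' (Icc (A + 1) P.C) (fun _ => .one) σ.B := by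
    unfold enhRun
    simp only [hcand]
    rfl
  rw [h3]
  refine ⟨A', hAA', P.skip_le _ _ _ _, h1, by rw [h2]; simp, by rw [h2]; simp,
    fun T hT hc hfit => ?_⟩
  refine P.card_le_sub_skip hT hc fun i hi => ?_
  have h4 : B .one = σ.B .one := by simp [hB]
  rw [h4]
  exact ((P.le_V_iff hn (hσ .one) i _).2 (hfit i hi)).trans (Nat.le_add_right _ _)

/-- Outcome of the processing of layer `n`. -/
structure LayerSpec (P : Instance) (n : ℕ) : Prop where
  fetched : Fetched P n (P.residual n) (P.run n)
  disj : Disjoint ((P.run n).I .one) ((P.run n).I .two)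
  suffix : ∃ A ≤ P.C, (P.run n).I .one ∪ (P.run n).I .two = Icc (A + 1) P.C

theorem layerSpec {n : ℕ} (hn : n ≤ P.N) : P.LayerSpec n := by
  induction n with
  | zero =>
    obtain ⟨A, hA, h1, h2, -⟩ := P.baseRun_spec
    exact ⟨h1, h2.disj, A, hA, h2.union⟩
  | succ n ih =>
    obtain ⟨h1, -, A, hA, h2⟩ := ih (by omega)
    obtain ⟨A', -, hA', h3, h4, h5, -⟩ := enhRun_spec hn h1.nonneg hA h2
    refine ⟨h3, ?_, A', hA', ?_⟩
    · change Disjoint _ ((P.enhRun (n + 1) (P.run n)).I .two)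
      rw [h5]; exact disjoint_empty_right _
    · change (P.enhRun (n + 1) (P.run n)).I .one ∪ (P.enhRun (n + 1) (P.run n)).I .two = _
      rw [h4, h5, union_empty]

theorem run_succ_spec {n : ℕ} (hn : n + 1 ≤ P.N) {A : ℕ} (hA : A ≤ P.C)
    (hcand : (P.run n).I .one ∪ (P.run n).I .two = Icc (A + 1) P.C) :
    ∃ A', A ≤ A' ∧ A' ≤ P.C ∧ (P.run (n + 1)).I .one = Icc (A' + 1) P.C ∧
      (P.run (n + 1)).I .two = ∅ ∧
      ∀ T ⊆ Icc 1 P.C, #T ≤ P.C - A →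
        (∀ i ∈ Icc 1 P.C, P.Y (n + 1) * cnt T i ≤ P.cum ((P.run n).B .one) i) →
        #T ≤ P.C - A' := by
  obtain ⟨A', h1, h2, -, h3⟩ :=
    enhRun_spec hn (layerSpec (P := P) (n := n) (by omega)).fetched.nonneg hA hcand
  exact ⟨A', h1, h2, h3⟩

theorem run_succ_subset {n : ℕ} (hn : n + 1 ≤ P.N) :
    (P.run (n + 1)).I .one ∪ (P.run (n + 1)).I .two ⊆ (P.run n).I .one ∪ (P.run n).I .two := by
  obtain ⟨A, hA, h⟩ := (layerSpec (P := P) (n := n) (by omega)).suffix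
  obtain ⟨A', h1, -, h2, h3, -⟩ := run_succ_spec hn hA h
  rw [h, h2, h3, union_empty]
  exact Icc_subset_Icc_left (by omega)

/-- The algorithm leaves as much bandwidth to early deadlines as its choice of chunks permits. -/
theorem run_lower {n : ℕ} (hn : n ≤ P.N) : ∀ i ∈ Icc 1 P.C, ∃ i' ∈ Icc i P.C,
    P.cum (P.B .one) i' - ∑ m ∈ range (n + 1), P.Y m * cnt ((P.run m).I .one) i' ≤
      P.cum ((P.run n).B .one) i := by
  induction n with
  | zero =>
    intro i hi
    simpa [residual] using (layerSpec hn).fetched.lower .one i hi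
  | succ n ih =>
    intro i hi
    obtain ⟨i', hi', h1⟩ := (layerSpec hn).fetched.lower .one i hi
    obtain ⟨i'', hi'', h2⟩ := ih (by omega) i' (by simp at hi hi' ⊢; omega)
    refine ⟨i'', by simp at hi' hi'' ⊢; omega, ?_⟩
    have h3 : P.cum (P.residual (n + 1) .one) i' = P.cum ((P.run n).B .one) i' := rfl
    have h4 : P.Y (n + 1) * cnt ((P.run (n + 1)).I .one) i' ≤
        P.Y (n + 1) * cnt ((P.run (n + 1)).I .one) i'' := by
      have := (P.Y_pos hn).le
      gcongr
      exact cnt_mono _ (mem_Icc.1 hi'').1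
    rw [sum_range_succ]
    linarith

end Instance

/-! ### The output of the algorithm is feasible -/

/-- The fetching plans of the layers are put together. The bandwidth constraint holds because the
residual profiles telescope and the last one is nonnegative. -/
theorem exists_feasible (P : Instance) :
    ∃ x : Policy, x.I = P.avoidSkips ∧ Feasible P 0 x := by
  classical
  have hplan : ∀ n, ∃ z : Link → ℕ → ℕ → ℝ, n ≤ P.N → (∀ k i j, 0 ≤ z k i j) ∧
      (∀ k i j, i ∉ (P.run n).I k ∨ j ∉ Icc 1 (P.deadline i) → z k i j = 0) ∧
      (∀ k, ∀ i ∈ (P.run n).I k, ∑ j ∈ Icc 1 (P.deadline i), z k i j = P.Y n) ∧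
      ∀ k j, (P.run n).B k j + ∑ i ∈ Icc 1 P.C, z k i j = P.residual n k j := by
    intro n
    by_cases hn : n ≤ P.N
    · obtain ⟨z, hz⟩ := (Instance.layerSpec hn).fetched.plan
      exact ⟨z, fun _ => hz⟩
    · exact ⟨0, fun h => absurd h hn⟩
  choose z hz using hplan
  have htele : ∀ n ≤ P.N, ∀ k j,
      (P.run n).B k j + ∑ m ∈ range (n + 1), ∑ i ∈ Icc 1 P.C, z m k i j = P.B k j := by
    intro n
    induction n with
    | zero => intro hn k j; simpa [Instance.residual] using (hz 0 hn).2.2.2 k j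
    | succ n ih =>
      intro hn k j
      have h1 := (hz (n + 1) hn).2.2.2 k j
      have h2 := ih (by omega) k j
      have h3 : P.residual (n + 1) k j = (P.run n).B k j := rfl
      rw [sum_range_succ]
      linarith
  have htwo : ∀ n ≤ P.N, 0 < n → (P.run n).I .two = ∅ := by
    intro n hn hpos
    obtain ⟨m, rfl⟩ : ∃ m, n = m + 1 := ⟨n - 1, by omega⟩
    obtain ⟨A, hA, h⟩ := (Instance.layerSpec (P := P) (n := m) (by omega)).suffix
    obtain ⟨A', -, -, -, h3, -⟩ := Instance.run_succ_spec hn hA h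
    exact h3
  refine ⟨⟨fun k n i j => z n k i j, fun k n i => if i ∈ (P.run n).I k then P.Y n else 0,
    fun n i => if i ∈ (P.run n).I .one ∪ (P.run n).I .two then P.Y n else 0, P.avoidSkips⟩, rfl,
    ⟨?_, ?_, ?_, ?_, ?_, ?_, ?_, ?_, ?_, ?_, ?_⟩⟩
  · intro k n hn i _
    obtain ⟨-, h2, h3, -⟩ := hz n hn
    by_cases hi : i ∈ (P.run n).I k
    · simpa [hi] using h3 k i hi
    · simpa [hi] using sum_eq_zero fun j _ => h2 k i j (Or.inl hi)
  · intro n hn i _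
    have hd : i ∈ (P.run n).I .one → i ∉ (P.run n).I .two := fun h =>
      disjoint_left.1 (Instance.layerSpec hn).disj h
    by_cases h1 : i ∈ (P.run n).I .one
    · simp [Instance.avoidSkips, h1, hd h1]
    · by_cases h2 : i ∈ (P.run n).I .two <;> simp [Instance.avoidSkips, h1, h2]
  · intro n hn i _
    obtain ⟨m, rfl⟩ : ∃ m, n = m + 1 := ⟨n - 1, by simp at hn; omega⟩
    have hm : m + 1 ≤ P.N := (mem_Icc.1 hn).2
    have h1 := P.Y_pos hm
    have h2 := P.Y_pos (n := m) (by omega)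
    simp only [Nat.add_sub_cancel]
    by_cases hi : i ∈ (P.run (m + 1)).I .one ∪ (P.run (m + 1)).I .two
    · rw [if_pos hi, if_pos (Instance.run_succ_subset hm hi), div_mul_cancel₀ _ h2.ne']
    · rw [if_neg hi]
      positivity
  · intro k j _
    have h1 := htele P.N le_rfl k j
    have h2 := (Instance.layerSpec (P := P) le_rfl).fetched.nonneg k j
    simp only
    linarith
  · intro n hn i _
    have hd : i ∈ (P.run n).I .one → i ∉ (P.run n).I .two := fun h =>
      disjoint_left.1 (Instance.layerSpec hn).disj h
    by_cases h1 : i ∈ (P.run n).I .one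
    · simp [hd h1]
    · simp [h1]
  · intro k n hn i _ j _
    exact (hz n hn).1 k i j
  · intro n hn hpos i _ j _
    exact (hz n hn).2.1 .two i j (Or.inl (by simp [htwo n hn hpos]))
  · intro k n hn i _ j _ hj
    exact (hz n hn).2.1 k i j (Or.inr (by simp; omega))
  · intro n hn i _
    simp only
    split_ifs <;> simp
  · intro k n hn i _
    simp only [Instance.avoidSkips]
    split_ifs <;> simp
  · intro k n hn i _
    have := (P.Y_pos hn).ne
    simp only [Instance.avoidSkips]
    split_ifs <;> simp [this]

/-! ### Upper bounds for feasible points -/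

/-- Properties of the sets `T k n` of chunks whose layer `n` is fetched over link `k` in a
feasible point. -/
structure Choice (P : Instance) (T : Link → ℕ → Finset ℕ) : Prop where
  sub : ∀ k n, T k n ⊆ Icc 1 P.C
  disj : ∀ n ≤ P.N, Disjoint (T .one n) (T .two n)
  two : ∀ n ≤ P.N, 0 < n → T .two n = ∅
  nested : ∀ n, n + 1 ≤ P.N → T .one (n + 1) ⊆ T .one n ∪ T .two n
  capacity : ∀ k, ∀ i ∈ Icc 1 P.C, ∑ n ∈ range (P.N + 1), P.Y n * cnt (T k n) i ≤ P.cum (P.B k) i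

/-- For `capacity`, a chunk `m ≤ i` has its deadline no later than chunk `i`, so its whole layer is
fetched by then. For `nested`, an unsplit layer on link 1 has positive size, which forces positive
size one layer below. -/
theorem Feasible.choice {x : Policy} (hx : Feasible P 0 x) :
    Choice P fun k n => {i ∈ Icc 1 P.C | x.I k n i = 1} := by
  have hdl : ∀ i ∈ Icc 1 P.C, ∀ j ∈ Icc 1 (P.deadline i), j ∈ Icc 1 (P.deadline P.C) :=
    fun i hi j hj => Icc_subset_Icc_right (P.deadline_mono (mem_Icc.1 hi).2) hj
  refine ⟨fun _ _ => filter_subset _ _, fun n hn => ?_, fun n hn hpos => ?_, fun n hn => ?_,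
    fun k i hi => ?_⟩
  · rw [disjoint_left]
    intro i h1 h2
    simp only [mem_filter] at h1 h2
    have h3 := hx.unsplit n hn i h1.1
    rw [(hx.decision .one n hn i h1.1).1 h1.2, (hx.decision .two n hn i h1.1).1 h2.2] at h3
    have := P.Y_pos hn
    exact absurd h3 (by positivity)
  · rw [filter_eq_empty_iff]
    intro i hi h
    have h1 := (hx.decision .two n hn i hi).1 h
    rw [← hx.total .two n hn i hi,
      sum_eq_zero fun j hj => hx.preference n hn hpos i hi j (hdl i hi j hj)] at h1
    exact (P.Y_pos hn).ne h1
  · intro i h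
    simp only [mem_filter, mem_union] at h ⊢
    obtain ⟨hi, h⟩ := h
    have hY := P.Y_pos hn
    have hY' := P.Y_pos (n := n) (by omega)
    have h1 := (hx.decision .one _ hn i hi).1 h
    have h2 := hx.unsplit _ hn i hi
    rw [h1] at h2
    have h3 : x.Zl .two (n + 1) i = 0 := (mul_eq_zero.1 h2).resolve_left hY.ne'
    have h4 := hx.size _ hn i hi
    rw [h, h1, h3, one_mul, mul_zero, add_zero] at h4
    have h5 := hx.nested (n + 1) (by simp; omega) i hi
    rw [← h4, Nat.add_sub_cancel] at h5
    have h6 := hx.size n (by omega) i hi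
    by_contra hcon
    have hone : x.I .one n i = 0 :=
      (hx.binary .one n (by omega) i hi).resolve_right fun h => hcon (Or.inl ⟨hi, h⟩)
    have htwo : x.I .two n i = 0 :=
      (hx.binary .two n (by omega) i hi).resolve_right fun h => hcon (Or.inr ⟨hi, h⟩)
    rw [hone, htwo, zero_mul, zero_mul, add_zero] at h6
    rw [← h6, mul_zero] at h5
    exact absurd h5 (not_le.2 hY)
  · have hz : ∀ n ≤ P.N, ∀ m ∈ Icc 1 P.C, ∀ j ∈ Icc 1 (P.deadline i), 0 ≤ x.z k n m j :=
      fun n hn m hm j hj => hx.nonneg k n hn m hm j (hdl i hi j hj)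
    calc ∑ n ∈ range (P.N + 1), P.Y n * cnt {m ∈ Icc 1 P.C | x.I k n m = 1} i
        ≤ ∑ n ∈ range (P.N + 1), ∑ m ∈ Icc 1 P.C, ∑ j ∈ Icc 1 (P.deadline i), x.z k n m j := by
          refine sum_le_sum fun n hn => ?_
          have hn : n ≤ P.N := by simp at hn; omega
          rw [cnt, mul_comm, ← nsmul_eq_mul, ← sum_const]
          refine (sum_le_sum fun m hm => ?_).trans (sum_le_sum_of_subset_of_nonneg
            ((filter_subset _ _).trans (filter_subset _ _)) fun m hm _ =>
              sum_nonneg fun j hj => hz n hn m hm j hj)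
          simp only [mem_filter] at hm
          rw [← (hx.decision k n hn m hm.1.1).1 hm.1.2, ← hx.total k n hn m hm.1.1]
          exact sum_le_sum_of_subset_of_nonneg (Icc_subset_Icc_right (P.deadline_mono hm.2))
            fun j hj _ => hz n hn m hm.1.1 j hj
      _ = ∑ j ∈ Icc 1 (P.deadline i), ∑ n ∈ range (P.N + 1), ∑ m ∈ Icc 1 P.C, x.z k n m j := by
          have h : ∀ n ∈ range (P.N + 1), ∑ m ∈ Icc 1 P.C, ∑ j ∈ Icc 1 (P.deadline i), x.z k n m j =
              ∑ j ∈ Icc 1 (P.deadline i), ∑ m ∈ Icc 1 P.C, x.z k n m j := fun _ _ => sum_comm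
          rw [sum_congr rfl h, sum_comm]
      _ ≤ P.cum (P.B k) i := sum_le_sum fun j hj => hx.bandwidth k j (hdl i hi j hj)

namespace Choice

variable {T : Link → ℕ → Finset ℕ}

theorem partial_capacity (hT : Choice P T) (k : Link) {n : ℕ} (hn : n ≤ P.N) {i : ℕ}
    (hi : i ∈ Icc 1 P.C) :
    ∑ m ∈ range (n + 1), P.Y m * cnt (T k m) i ≤ P.cum (P.B k) i := by
  refine (sum_le_sum_of_subset_of_nonneg (range_subset_range.2 (by omega)) fun m hm _ => ?_).trans
    (hT.capacity k i hi)
  have := P.Y_pos (n := m) (by simp at hm; omega)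
  positivity

theorem base_fits (hT : Choice P T) (k : Link) : FitsIn P.C (P.V 0 (P.B k)) (T k 0) :=
  fun i hi => (P.le_V_iff (Nat.zero_le _) (P.B_nonneg k) i _).2 <| by
    simpa using hT.partial_capacity k (Nat.zero_le _) hi

theorem base_union_le (hT : Choice P T) :
    #(T .one 0) + #(T .two 0) ≤ #((P.run 0).I .one) + #((P.run 0).I .two) := by
  obtain ⟨A, hA, -, h2, -, h4⟩ := P.baseRun_spec
  have hd := hT.disj 0 (Nat.zero_le _)
  rw [← card_union_of_disjoint hd, ← card_union_of_disjoint (s := (P.run 0).I .one) (t := (P.run 0).I .two) h2.disj]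
  refine (h4 _ (union_subset (hT.sub _ _) (hT.sub _ _)) fun i hi => ?_).trans_eq ?_
  · rw [cnt_union hd]
    exact Nat.add_le_add (hT.base_fits .one i hi) (hT.base_fits .two i hi)
  · rw [show (P.run 0).I .one ∪ (P.run 0).I .two = _ from h2.union, Nat.card_Icc]
    omega

/-- `MoveInv.card_fst_max` needs a set no larger than the suffix; the bound on the total supplies
this. -/
theorem base_one_le (hT : Choice P T) : #(T .one 0) ≤ #((P.run 0).I .one) := by
  obtain ⟨A, hA, -, h2, h3, -⟩ := P.baseRun_spec
  refine h2.card_fst_max h3 (hT.base_fits .one) (hT.sub _ _) ?_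
  have h5 := hT.base_union_le
  rw [← card_union_of_disjoint (s := (P.run 0).I .one) (t := (P.run 0).I .two) h2.disj] at h5
  have h6 : #((P.run 0).I .one ∪ (P.run 0).I .two) = P.C + 1 - (A + 1) := by
    rw [← Nat.card_Icc]; exact congrArg card h2.union
  omega

theorem base_cnt_le (hT : Choice P T) (h₁ : #(T .one 0) = #((P.run 0).I .one))
    (h₂ : #(T .two 0) = #((P.run 0).I .two)) (i : ℕ) :
    cnt ((P.run 0).I .one) i ≤ cnt (T .one 0) i := by
  obtain ⟨A, hA, -, h, -⟩ := P.baseRun_spec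
  exact h.cnt_fst_le (hT.disj 0 (Nat.zero_le _)) (union_subset (hT.sub _ _) (hT.sub _ _))
    (hT.base_fits .two) h₁ h₂ i

/-- The core of optimality for enhancement layers: up to every deadline the algorithm has spent no
more of link 1 on the earlier layers than the competitor, and it has equally many candidates. -/
theorem enh_le (hT : Choice P T) {n : ℕ} (hn : n + 1 ≤ P.N)
    (h₁ : ∀ m ≤ n, #(T .one m) = #((P.run m).I .one))
    (h₂ : #(T .two 0) = #((P.run 0).I .two)) :
    #(T .one (n + 1)) ≤ #((P.run (n + 1)).I .one) := by
  obtain ⟨A, hA, hS⟩ := (Instance.layerSpec (P := P) (n := n) (by omega)).suffix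
  have hdS := (Instance.layerSpec (P := P) (n := n) (by omega)).disj
  have hrun : ∀ m, m + 1 ≤ P.N → ∃ A, A ≤ P.C ∧
      (P.run (m + 1)).I .one = Icc (A + 1) P.C ∧ (P.run (m + 1)).I .two = ∅ := by
    intro m hm
    obtain ⟨A, hA, hS⟩ := (Instance.layerSpec (P := P) (n := m) (by omega)).suffix
    obtain ⟨A', -, h1, h2, h3, -⟩ := Instance.run_succ_spec hm hA hS
    exact ⟨A', h1, h2, h3⟩
  -- For the base layer this is the lateness of link 1; an enhancement layer occupies a suffix.
  have hcnt : ∀ m ≤ n, ∀ i ∈ Icc 1 P.C, cnt ((P.run m).I .one) i ≤ cnt (T .one m) i := by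
    intro m hm i hi
    cases m with
    | zero => exact hT.base_cnt_le (h₁ 0 hm) h₂ i
    | succ m =>
      obtain ⟨A, hA, h, -⟩ := hrun m (by omega)
      have hc := h₁ _ hm
      rw [h, Nat.card_Icc] at hc
      rw [h]
      have := cnt_suffix_le (hT.sub .one (m + 1)) le_rfl (mem_Icc.1 hi).2
      rwa [show P.C - #(T .one (m + 1)) + 1 = A + 1 by omega] at this
  have htwo : #(T .two n) = #((P.run n).I .two) := by
    cases n with
    | zero => exact h₂
    | succ m =>
      obtain ⟨A, -, -, h⟩ := hrun m (by omega)
      rw [h, hT.two _ (by omega) (by omega)]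
  obtain ⟨A', hAA', hA', h3, -, h4⟩ := Instance.run_succ_spec hn hA hS
  rw [h3, Nat.card_Icc, Nat.add_sub_add_right]
  refine h4 _ (hT.sub _ _) ?_ fun i hi => ?_
  · have h5 := card_le_card (hT.nested n hn)
    rw [card_union_of_disjoint (hT.disj n (by omega)), h₁ n le_rfl, htwo,
      ← card_union_of_disjoint hdS, hS, Nat.card_Icc] at h5
    omega
  -- At the later deadline `i'` the competitor's capacity pays for its own layer `n + 1` on top of
  -- its earlier layers, which need at least what the algorithm's do.
  · obtain ⟨i', hi', h5⟩ := Instance.run_lower (P := P) (n := n) (by omega) i hi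
    have hi'' : i' ∈ Icc 1 P.C := by simp at hi hi' ⊢; omega
    have h6 := hT.partial_capacity .one hn hi''
    rw [sum_range_succ] at h6
    have h7 : ∑ m ∈ range (n + 1), P.Y m * cnt ((P.run m).I .one) i' ≤
        ∑ m ∈ range (n + 1), P.Y m * cnt (T .one m) i' := by
      refine sum_le_sum fun m hm => ?_
      have hm : m ≤ n := by simp at hm; omega
      have := (P.Y_pos (n := m) (by omega)).le
      gcongr
      exact hcnt m hm i' hi''
    have h8 : P.Y (n + 1) * cnt (T .one (n + 1)) i ≤ P.Y (n + 1) * cnt (T .one (n + 1)) i' := by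
      have := (P.Y_pos hn).le
      gcongr
      exact cnt_mono _ (mem_Icc.1 hi').1
    linarith

end Choice

/-! ### Weights -/

/-- If each weight outweighs `C` times the later ones, then the weighted sum is monotone for the
lexicographic order on sequences bounded by `C`. -/
theorem sum_le_sum_of_lex {C len : ℕ} {w : ℕ → ℝ} {k k' : ℕ → ℕ} (hk : ∀ n < len, k n ≤ C)
    (hw0 : ∀ a < len, 0 ≤ w a)
    (hw : ∀ a < len, C * ∑ n ∈ range (len - (a + 1)), w (a + 1 + n) ≤ w a)
    (hlex : ∀ n < len, (∀ m < n, k m = k' m) → k n ≤ k' n) :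
    ∑ n ∈ range len, w n * k n ≤ ∑ n ∈ range len, w n * k' n := by
  induction len generalizing w k k' with
  | zero => simp
  | succ len ih =>
    rw [sum_range_succ', sum_range_succ' _ len]
    have h0 := hlex 0 (by omega) (by simp)
    rcases h0.eq_or_lt with h | h
    · rw [h]
      gcongr ?_ + _
      refine ih (w := fun n => w (n + 1)) (k := fun n => k (n + 1)) (k' := fun n => k' (n + 1))
        (fun n hn => hk _ (by omega)) (fun a ha => hw0 _ (by omega)) (fun a ha => ?_)
        fun n hn hm => hlex _ (by omega) fun m hm' => ?_
      · have := hw (a + 1) (by omega)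
        rw [Nat.add_sub_add_right] at this
        refine le_trans (le_of_eq ?_) this
        congr 1
        exact sum_congr rfl fun n _ => by congr 1; omega
      · cases m with
        | zero => exact h
        | succ m => exact hm m (by omega)
    -- A deficit of one unit in the leading term outweighs the whole tail.
    · have h1 : ∑ n ∈ range len, w (n + 1) * k (n + 1) ≤ w 0 := by
        refine le_trans ?_ (hw 0 (by omega))
        rw [mul_sum]
        refine sum_le_sum fun n hn => ?_
        have hn : n < len := by simpa using hn
        have h2 := hw0 (n + 1) (by omega)
        have h3 : (k (n + 1) : ℝ) ≤ C := by exact_mod_cast hk (n + 1) (by omega)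
        rw [zero_add, add_comm 1 n, mul_comm]
        gcongr
      have h2 : 0 ≤ ∑ n ∈ range len, w (n + 1) * k' (n + 1) := by
        refine sum_nonneg fun n hn => ?_
        have := hw0 (n + 1) (by simp at hn; omega)
        positivity
      have h3 : w 0 * ((k 0 : ℝ) + 1) ≤ w 0 * k' 0 := by
        have := hw0 0 (by omega)
        gcongr
        exact_mod_cast h
      linarith

/-- Weights in order of importance: the base layer over link 1, the base layer over link 2, the
enhancement layers over link 1. -/
def ranked {α : Type*} (f : Link → ℕ → α) : ℕ → α
  | 0 => f .one 0
  | 1 => f .two 0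
  | n + 2 => f .one (n + 1)

/-- Only cardinalities matter, and link 2 contributes only its base layers; hence `M + 2` ranked
terms. -/
theorem objective_eq (lam : Link → ℕ → ℝ) {M : ℕ} {I : Link → ℕ → ℕ → ℝ}
    {T : Link → ℕ → Finset ℕ} (hsub : ∀ k, ∀ n ≤ M, T k n ⊆ Icc 1 P.C)
    (hI : ∀ k, ∀ n ≤ M, ∀ i ∈ Icc 1 P.C, I k n i = if i ∈ T k n then 1 else 0)
    (htwo : ∀ n ≤ M, 0 < n → T .two n = ∅) :
    objective P lam M I =
      ∑ n ∈ range (M + 2), ranked lam n * ranked (fun k n => #(T k n)) n := by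
  have hcard : ∀ k, ∀ n ≤ M, ∑ i ∈ Icc 1 P.C, lam k n * I k n i = lam k n * #(T k n) := by
    intro k n hn
    rw [← mul_sum, sum_congr rfl (hI k n hn), sum_ite_mem, sum_const, nsmul_eq_mul, mul_one,
      inter_eq_right.2 (hsub k n hn)]
  have h1 : objective P lam M I =
      ∑ n ∈ range (M + 1), (lam .one n * #(T .one n) + lam .two n * #(T .two n)) := by
    unfold objective
    rw [sum_comm]
    refine sum_congr rfl fun n hn => ?_
    have hn : n ≤ M := by simp at hn; omega
    rw [sum_add_distrib, hcard _ n hn, hcard _ n hn]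
  rw [h1, sum_range_succ', sum_range_succ' _ (M + 1), sum_range_succ' _ M]
  have h2 : ∀ n ∈ range M, lam .one (n + 1) * (#(T .one (n + 1)) : ℝ) +
      lam .two (n + 1) * #(T .two (n + 1)) = lam .one (n + 1) * #(T .one (n + 1)) := by
    intro n hn
    rw [htwo (n + 1) (by simp at hn; omega) (by omega)]
    simp
  rw [sum_congr rfl h2]
  simp only [ranked]
  ring

/-- A truncated tail of a sequence that is nonnegative up to `N` is at most the whole tail. -/
theorem sum_range_le_sum_Icc {f : ℕ → ℝ} {a M N : ℕ} (hMN : M ≤ N)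
    (hf : ∀ n ≤ N, 0 ≤ f n) :
    ∑ n ∈ range (M + 1 - a), f (a + n) ≤ ∑ n ∈ Icc a N, f n := by
  rw [← sum_Ico_eq_sum_range]
  refine sum_le_sum_of_subset_of_nonneg (fun n hn => ?_) fun n hn _ => hf n (mem_Icc.1 hn).2
  simp at hn ⊢
  omega

/-- Downward induction on the layer: each weight exceeds a multiple of a sum of later, positive
ones. -/
theorem lam_two_pos {P : Instance} {lam : Link → ℕ → ℝ}
    (h : ∀ a ≤ P.N, (P.C : ℝ) * ∑ n ∈ Icc (a + 1) P.N, lam .two n * P.Y n < lam .two a) {a : ℕ}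
    (ha : a ≤ P.N) : 0 < lam .two a := by
  obtain ⟨d, hd⟩ : ∃ d, P.N - a = d := ⟨_, rfl⟩
  induction d using Nat.strong_induction_on generalizing a with
  | _ d ih =>
    refine lt_of_le_of_lt ?_ (h a ha)
    refine mul_nonneg (Nat.cast_nonneg _) (sum_nonneg fun n hn => ?_)
    have hn := mem_Icc.1 hn
    exact mul_nonneg (ih (P.N - n) (by omega) hn.2 rfl).le (P.Y_pos hn.2).le

theorem lam_one_pos {P : Instance} {lam : Link → ℕ → ℝ} (htwo : ∀ a ≤ P.N, 0 < lam .two a)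
    (h : ∀ a ≤ P.N, (P.C : ℝ) * (∑ n ∈ Icc a P.N, lam .two n
        + ∑ n ∈ Icc (a + 1) P.N, lam .one n) < lam .one a) {a : ℕ}
    (ha : a ≤ P.N) : 0 < lam .one a := by
  obtain ⟨d, hd⟩ : ∃ d, P.N - a = d := ⟨_, rfl⟩
  induction d using Nat.strong_induction_on generalizing a with
  | _ d ih =>
    refine lt_of_le_of_lt ?_ (h a ha)
    refine mul_nonneg (Nat.cast_nonneg _) (add_nonneg (sum_nonneg fun n hn => ?_)
      (sum_nonneg fun n hn => ?_))
    · exact (htwo n (mem_Icc.1 hn).2).le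
    · have hn := mem_Icc.1 hn
      exact (ih (P.N - n) (by omega) hn.2 rfl).le

theorem objective_le {P : Instance} {lam : Link → ℕ → ℝ}
    (hlam₁ : ∀ a ≤ P.N, (P.C : ℝ) * (∑ n ∈ Icc a P.N, lam .two n
        + ∑ n ∈ Icc (a + 1) P.N, lam .one n) < lam .one a)
    (hlam₂ : ∀ a ≤ P.N, (P.C : ℝ) * ∑ n ∈ Icc (a + 1) P.N, lam .two n * P.Y n < lam .two a)
    (hbase : (P.C : ℝ) * ∑ n ∈ Icc 1 P.N, lam .one n < lam .two 0)
    {M : ℕ} (hM : M ≤ P.N) {x : Policy} (hx : Feasible P 0 x) :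
    objective P lam M x.I ≤ objective P lam M P.avoidSkips := by
  have htwo : ∀ a ≤ P.N, 0 < lam .two a := fun a ha => lam_two_pos hlam₂ ha
  have hone : ∀ a ≤ P.N, 0 < lam .one a := fun a ha => lam_one_pos htwo hlam₁ ha
  have hT := hx.choice
  rw [objective_eq lam (T := fun k n => {i ∈ Icc 1 P.C | x.I k n i = 1})
      (fun k n _ => hT.sub k n) (fun k n hn i hi => ?_)
      (fun n hn => hT.two n (hn.trans hM)),
    objective_eq lam (I := P.avoidSkips) (T := fun k n => (P.run n).I k)
      (fun k n hn => (Instance.layerSpec (hn.trans hM)).fetched.sub k)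
      (fun k n _ i _ => rfl) (fun n hn hpos => ?_)]
  · refine sum_le_sum_of_lex (C := P.C) (fun n _ => ?_) (fun a ha => ?_) (fun a ha => ?_)
      fun n hn hm => ?_
    · have h1 : ∀ k n, #{i ∈ Icc 1 P.C | x.I k n i = 1} ≤ P.C := fun k n =>
        (card_le_card (filter_subset _ _)).trans (by simp)
      rcases n with _ | _ | n
      · exact h1 .one 0
      · exact h1 .two 0
      · exact h1 .one (n + 1)
    · rcases a with _ | _ | a
      · exact (hone 0 (by omega)).le
      · exact (htwo 0 (by omega)).le
      · exact (hone (a + 1) (by omega)).le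
    · have htail : ∀ a, ∑ n ∈ range (M + 1 - a), lam .one (a + n) ≤ ∑ n ∈ Icc a P.N, lam .one n :=
        fun a => sum_range_le_sum_Icc hM fun n hn => (hone n hn).le
      rcases a with _ | _ | a
      · refine le_trans ?_ (hlam₁ 0 (by omega)).le
        gcongr
        rw [show M + 2 - (0 + 1) = M + 1 by omega, sum_range_succ', add_comm]
        refine add_le_add ?_ ?_
        · exact single_le_sum (f := lam .two) (fun n hn => (htwo n (mem_Icc.1 hn).2).le)
            (by simp : 0 ∈ Icc 0 P.N)
        · refine le_trans (le_of_eq ?_) (htail 1)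
          refine sum_congr (by simp) fun n _ => ?_
          rw [show 0 + 1 + (n + 1) = n + 2 by omega, add_comm 1 n]
          rfl
      · refine le_trans ?_ hbase.le
        gcongr
        refine le_trans (le_of_eq ?_) (htail 1)
        refine sum_congr (by congr 1) fun n _ => ?_
        rw [show 0 + 1 + 1 + n = n + 2 by omega, add_comm 1 n]
        rfl
      · refine le_trans ?_ (hlam₁ (a + 1) (by omega)).le
        gcongr
        refine le_trans (le_trans (le_of_eq ?_) (htail (a + 1 + 1)))
          (le_add_of_nonneg_left (sum_nonneg fun n hn => (htwo n (mem_Icc.1 hn).2).le))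
        refine sum_congr (by congr 1; omega) fun n _ => ?_
        rw [show a + 1 + 1 + 1 + n = (a + 1 + n) + 2 by omega,
          show a + 1 + 1 + n = (a + 1 + n) + 1 by omega]
        rfl
    · rcases n with _ | _ | n
      · exact hT.base_one_le
      -- With equal numbers on link 1, the bound on the total becomes a bound for link 2.
      · have h0 := hm 0 (by omega)
        have h1 := hT.base_union_le
        simp only [ranked] at h0 ⊢
        omega
      · refine hT.enh_le (by omega) (fun m hmn => ?_) (hm 1 (by omega))
        rcases m with _ | m
        · exact hm 0 (by omega)
        · exact hm (m + 2) (by omega)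
  · obtain ⟨m, rfl⟩ : ∃ m, n = m + 1 := ⟨n - 1, by omega⟩
    obtain ⟨A, hA, h⟩ := (Instance.layerSpec (P := P) (n := m) (by omega)).suffix
    obtain ⟨A', -, -, -, h3, -⟩ := Instance.run_succ_spec (by omega) hA h
    exact h3
  · rcases hx.binary k n (hn.trans hM) i hi with h | h <;> simp [h, mem_Icc.1 hi]

end SVCStream

theorem theorem1 (P : SVCStream.Instance) (lam : SVCStream.Link → ℕ → ℝ)
    (hlam₁ : ∀ a ≤ P.N, (P.C : ℝ) * (∑ n ∈ Finset.Icc a P.N, lam .two n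
        + ∑ n ∈ Finset.Icc (a + 1) P.N, lam .one n) < lam .one a)
    (hlam₂ : ∀ a ≤ P.N,
      (P.C : ℝ) * ∑ n ∈ Finset.Icc (a + 1) P.N, lam .two n * P.Y n < lam .two a)
    (hbase : (P.C : ℝ) * ∑ n ∈ Finset.Icc 1 P.N, lam .one n < lam .two 0) :
    (∃ x : SVCStream.Policy, x.I = P.avoidSkips ∧ SVCStream.Feasible P 0 x) ∧
      ∀ M ≤ P.N, ∀ x : SVCStream.Policy, SVCStream.Feasible P 0 x →
        SVCStream.objective P lam M x.I ≤ SVCStream.objective P lam M P.avoidSkips :=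
  ⟨SVCStream.exists_feasible P, fun _ hM _ hx =>
    SVCStream.objective_le hlam₁ hlam₂ hbase hM hx⟩
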